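/- For $a>0$ and $S>0$ consider the Cauchy problem $$\begin{cases} u'' = -\,v'^2\big(u-\tfrac1u\big)+u'v'v,\\ v'' = v'u'\big(u-\tfrac1u\big)-u'^2 v,\end{cases}\qquad s\in(0,S],\qquad\qquad u(0)=0,\quad v(0)=a,\quad u'(0)=1,\quad v'(0)=0, \tag{$*$}$$ for functions $u,v\in C^2([0,S])$ with $u\neq0$ on $(0,S]$ (derivatives at the endpoints of $[0,S]$ are one-sided). **Lemma 5.10.** For every $\alpha\in[-\pi/2,0)$ there exist $a>0$ and $S>0$ such that $(*)$ has a unique solution $(u,v)$ on $[0,S]$, and this solution meets the horizontal axis $v=0$ for the first time at $s=S$, with tangent vector $(\cos\alpha,\sin\alpha)$; that is, $u>0$ on $(0,S]$, $v>0$ on $[0,S)$, and $$v(S)=0,\qquad u'(S)=\cos\alpha,\qquad v'(S)=\sin\alpha .$$ -/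

import Mathlib

/-- `(u, v)` is a solution of class `C²([0, S])` of the degenerate Cauchy problem
`u'' = -v'² (u - 1/u) + u' v' v`, `v'' = v' u' (u - 1/u) - u'² v` on `(0, S]`,
`u(0) = 0`, `v(0) = a`, `u'(0) = 1`, `v'(0) = 0`.
Derivatives are taken within `[0, S]`, so they are one-sided at the two endpoints.
The field `u_ne_zero` says that the term `1/u` makes sense wherever the equations are imposed. -/
structure IsProfileSolution (a S : ℝ) (u v : ℝ → ℝ) : Prop where
  contDiffOn_u : ContDiffOn ℝ 2 u (Set.Icc 0 S)
  contDiffOn_v : ContDiffOn ℝ 2 v (Set.Icc 0 S)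
  u_zero : u 0 = 0
  v_zero : v 0 = a
  deriv_u_zero : derivWithin u (Set.Icc 0 S) 0 = 1
  deriv_v_zero : derivWithin v (Set.Icc 0 S) 0 = 0
  u_ne_zero : ∀ s ∈ Set.Ioc 0 S, u s ≠ 0
  ode_u : ∀ s ∈ Set.Ioc 0 S,
    derivWithin (derivWithin u (Set.Icc 0 S)) (Set.Icc 0 S) s =
      -(derivWithin v (Set.Icc 0 S) s) ^ 2 * (u s - 1 / u s) +
        derivWithin u (Set.Icc 0 S) s * derivWithin v (Set.Icc 0 S) s * v s
  ode_v : ∀ s ∈ Set.Ioc 0 S,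
    derivWithin (derivWithin v (Set.Icc 0 S)) (Set.Icc 0 S) s =
      derivWithin v (Set.Icc 0 S) s * derivWithin u (Set.Icc 0 S) s * (u s - 1 / u s) -
        (derivWithin u (Set.Icc 0 S) s) ^ 2 * v s

/-!
Solutions have unit speed, so with `(u', v') = (cos θ, sin θ)` the problem says that `(u, v)` is the
profile curve, leaving the axis of rotation orthogonally at height `a`, of a surface of revolution
with `θ' = sin θ (u - 1/u) - v cos θ`.

*Existence.* For `α = -π/2` the solution is an arc of the circle of radius `√2`
(`exists_profile_of_right_angle`). For `α ∈ (-π/2, 0)` put `σ = -sin α` and write the curve as a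
graph `v = f(x)` over the radius, with `q = sin θ`. Then
`f' = q / √(1 - q²)` and `(x q)' = x (x q - f √(1 - q²))`, and the singular term has become linear.
With `q` truncated to `[-σ, 0]` and `f` to `[0, A]` the right-hand sides are globally Lipschitz, and
one contraction argument gives solutions for all `a ∈ [0, A]`, jointly continuous in `(a, x)`
(`exists_volterra_solution`, `exists_isTruncGraph`). For `a = 0` the solution has `q = 0`, whereas
for `a = A` the value `q = -σ` is passed while `f > 0`. Let `a` be the least height for which
`q ≤ -σ` happens at a point with `f ≥ 0`. By minimality `q ≥ -σ` up to the point `X` where `f`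
vanishes, so the truncation is inactive there and `-σ` is a minimum of `q` on `[0, X]`. It is not
attained in the interior, because `q' = 0` forces `q'' = q / x² < 0`; hence `q(X) = -σ`, which is the
required angle (`exists_graph_with_angle`). Inverting the arc length function gives `(u, v)`.

*Uniqueness.* The difference of two solutions is measured by
`E = ((u - u₁)/s)² + (u' - u₁')² + (v' - v₁')² + (v - v₁)²`. The only unbounded coefficient in
`E'` multiplies `(v' - v₁')²` and is negative near `s = 0`, and unit speed gives
`u' - u₁' = O(s (|u' - u₁'| + |v' - v₁'|))`, which compensates the derivative of the quotient
`(u - u₁)/s`. So `E' ≤ C E` and `E = 0` (`energy_estimate`, `IsProfileSolution.eqOn`).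
-/

open Set Filter Topology

/-! ### Differential inequalities -/

theorem antitoneOn_Icc_of_hasDerivAt_nonpos {f f' : ℝ → ℝ} {b c : ℝ}
    (hc : ContinuousOn f (Icc b c)) (hd : ∀ x ∈ Ioo b c, HasDerivAt f (f' x) x)
    (hle : ∀ x ∈ Ioo b c, f' x ≤ 0) : AntitoneOn f (Icc b c) := by
  refine antitoneOn_of_deriv_nonpos (convex_Icc b c) hc ?_ ?_
  · rw [interior_Icc]
    exact fun x hx => (hd x hx).differentiableAt.differentiableWithinAt
  · rw [interior_Icc]
    intro x hx
    rw [(hd x hx).deriv]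
    exact hle x hx

/-- A form of Grönwall's inequality that asks for the differential inequality in the open interval
only, so that it applies to equations that are singular at the initial time. -/
theorem eq_zero_of_deriv_le_mul_self {E E' : ℝ → ℝ} {S C : ℝ} (hc : ContinuousOn E (Icc 0 S))
    (h0 : E 0 = 0) (hpos : ∀ s ∈ Icc 0 S, 0 ≤ E s)
    (hd : ∀ s ∈ Ioo 0 S, HasDerivAt E (E' s) s) (hle : ∀ s ∈ Ioo 0 S, E' s ≤ C * E s) :
    ∀ s ∈ Icc 0 S, E s = 0 := by
  intro s hs
  have hanti : AntitoneOn (fun t => E t * Real.exp (-(C * t))) (Icc 0 S) := by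
    refine antitoneOn_Icc_of_hasDerivAt_nonpos
      (f' := fun t => E' t * Real.exp (-(C * t)) + E t * (Real.exp (-(C * t)) * -C))
      (hc.mul (by fun_prop)) ?_ ?_
    · intro t ht
      refine (hd t ht).mul ?_
      have h : HasDerivAt (fun t : ℝ => -(C * t)) (-(C * 1)) t :=
        ((hasDerivAt_id t).const_mul C).neg
      rw [mul_one] at h
      exact h.exp
    · intro t ht
      have h1 := hle t ht
      have h2 := Real.exp_pos (-(C * t))
      nlinarith
  have h1 := hanti (left_mem_Icc.2 (hs.1.trans hs.2)) hs hs.1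
  simp only [h0, zero_mul] at h1
  have h2 := Real.exp_pos (-(C * s))
  exact le_antisymm (nonpos_of_mul_nonpos_left h1 h2) (hpos s hs)

/-! ### Uniqueness for the degenerate Cauchy problem -/

/-- A solution together with its velocity `(P, Q)`, and the a priori bounds, with a common constant
`M`, that control the singular term `1 / u` near `s = 0`. The equations are recorded in the open
interval only, where the derivatives are two-sided. -/
structure IsBoundedProfile (a S M : ℝ) (u v P Q : ℝ → ℝ) : Prop where
  cont_u : ContinuousOn u (Icc 0 S)
  cont_v : ContinuousOn v (Icc 0 S)
  cont_P : ContinuousOn P (Icc 0 S)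
  cont_Q : ContinuousOn Q (Icc 0 S)
  u_zero : u 0 = 0
  v_zero : v 0 = a
  P_zero : P 0 = 1
  Q_zero : Q 0 = 0
  deriv_u_zero : HasDerivWithinAt u 1 (Icc 0 S) 0
  deriv_u : ∀ s ∈ Ioo 0 S, HasDerivAt u (P s) s
  deriv_v : ∀ s ∈ Ioo 0 S, HasDerivAt v (Q s) s
  deriv_P : ∀ s ∈ Ioo 0 S,
    HasDerivAt P (-(Q s) ^ 2 * (u s - 1 / u s) + P s * Q s * v s) s
  deriv_Q : ∀ s ∈ Ioo 0 S,
    HasDerivAt Q (Q s * P s * (u s - 1 / u s) - (P s) ^ 2 * v s) s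
  speed : ∀ s ∈ Ioo 0 S, P s ^ 2 + Q s ^ 2 = 1
  u_pos : ∀ s ∈ Ioo 0 S, 0 < u s
  le_u : ∀ s ∈ Ioo 0 S, s ≤ M * u s
  abs_Q : ∀ s ∈ Ioo 0 S, |Q s| ≤ M * s
  abs_P : ∀ s ∈ Ioo 0 S, |P s - 1| ≤ M * s
  abs_u : ∀ s ∈ Ioo 0 S, |u s| ≤ M
  abs_v : ∀ s ∈ Ioo 0 S, |v s| ≤ M

theorem IsBoundedProfile.mono {a S M M' : ℝ} {u v P Q : ℝ → ℝ}
    (h : IsBoundedProfile a S M u v P Q) (hM : M ≤ M') : IsBoundedProfile a S M' u v P Q :=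
  { h with
    le_u := fun s hs => (h.le_u s hs).trans (mul_le_mul_of_nonneg_right hM (h.u_pos s hs).le)
    abs_Q := fun s hs => (h.abs_Q s hs).trans (mul_le_mul_of_nonneg_right hM hs.1.le)
    abs_P := fun s hs => (h.abs_P s hs).trans (mul_le_mul_of_nonneg_right hM hs.1.le)
    abs_u := fun s hs => (h.abs_u s hs).trans hM
    abs_v := fun s hs => (h.abs_v s hs).trans hM }

theorem abs_mul_abs_le_of_sq_le {x y E : ℝ} (hx : x ^ 2 ≤ E) (hy : y ^ 2 ≤ E) :
    |x| * |y| ≤ E := by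
  nlinarith [sq_nonneg (|x| - |y|), sq_abs x, sq_abs y]

/-- Bounds one term of the derivative of the energy: a linear combination of differences with
coefficients bounded by `K`, multiplied by a difference. -/
theorem mul_linear_le {z A₁ A₂ A₃ A₄ r p q w K E : ℝ} (h₁ : |A₁| ≤ K) (h₂ : |A₂| ≤ K)
    (h₃ : |A₃| ≤ K) (h₄ : |A₄| ≤ K) (hz : z ^ 2 ≤ E) (hr : r ^ 2 ≤ E) (hp : p ^ 2 ≤ E)
    (hq : q ^ 2 ≤ E) (hw : w ^ 2 ≤ E) :
    z * (A₁ * r + A₂ * p + A₃ * q + A₄ * w) ≤ 4 * K * E := by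
  have hK : 0 ≤ K := (abs_nonneg _).trans h₁
  have key : ∀ A x : ℝ, |A| ≤ K → x ^ 2 ≤ E → z * (A * x) ≤ K * E := by
    intro A x hA hx
    calc z * (A * x) ≤ |z * (A * x)| := le_abs_self _
      _ = |A| * (|z| * |x|) := by rw [abs_mul, abs_mul]; ring
      _ ≤ K * (|z| * |x|) := by gcongr
      _ ≤ K * E := mul_le_mul_of_nonneg_left (abs_mul_abs_le_of_sq_le hz hx) hK
  have e₁ := key A₁ r h₁ hr
  have e₂ := key A₂ p h₂ hp
  have e₃ := key A₃ q h₃ hq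
  have e₄ := key A₄ w h₄ hw
  linarith

set_option maxHeartbeats 1000000 in
/-- The pointwise energy estimate behind uniqueness. The difference of two solutions is measured
by `r = (u - u₁) / s`, `P - P₁`, `Q - Q₁` and `v - v₁`; the only unbounded coefficient,
that of `(Q - Q₁) ^ 2`, has a favourable sign. -/
theorem energy_estimate {M s u v P Q u₁ v₁ P₁ Q₁ : ℝ} (hM : 1 ≤ M) (hs : 0 < s) (hsM : s ≤ M)
    (hu : 0 < u) (hu₁ : 0 < u₁) (hsu : s ≤ M * u) (hsu₁ : s ≤ M * u₁)
    (hQ : |Q| ≤ M * s) (hQ₁ : |Q₁| ≤ M * s) (hP : |P - 1| ≤ M * s) (hP₁ : |P₁ - 1| ≤ M * s)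
    (hsp : P ^ 2 + Q ^ 2 = 1) (hsp₁ : P₁ ^ 2 + Q₁ ^ 2 = 1)
    (huM : |u| ≤ M) (hvM : |v| ≤ M) :
    2 * ((u - u₁) / s) * (((P - P₁) * s - (u - u₁)) / s ^ 2) +
      2 * (P - P₁) * ((-Q ^ 2 * (u - 1 / u) + P * Q * v) -
        (-Q₁ ^ 2 * (u₁ - 1 / u₁) + P₁ * Q₁ * v₁)) +
      2 * (Q - Q₁) * ((Q * P * (u - 1 / u) - P ^ 2 * v) -
        (Q₁ * P₁ * (u₁ - 1 / u₁) - P₁ ^ 2 * v₁)) +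
      2 * (v - v₁) * (Q - Q₁) ≤
    100 * M ^ 4 * (((u - u₁) / s) ^ 2 + (P - P₁) ^ 2 + (Q - Q₁) ^ 2 + (v - v₁) ^ 2) := by
  obtain ⟨r, hr⟩ : ∃ r, r = (u - u₁) / s := ⟨_, rfl⟩
  have hdu : u - u₁ = s * r := by rw [hr]; field_simp
  rw [← hr]
  obtain ⟨E, hE⟩ : ∃ E, E = r ^ 2 + (P - P₁) ^ 2 + (Q - Q₁) ^ 2 + (v - v₁) ^ 2 := ⟨_, rfl⟩
  rw [← hE]
  have nr := sq_nonneg r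
  have np := sq_nonneg (P - P₁)
  have nq := sq_nonneg (Q - Q₁)
  have nv := sq_nonneg (v - v₁)
  have er : r ^ 2 ≤ E := by linarith
  have ep : (P - P₁) ^ 2 ≤ E := by linarith
  have eq : (Q - Q₁) ^ 2 ≤ E := by linarith
  have ev : (v - v₁) ^ 2 ≤ E := by linarith
  have hE0 : 0 ≤ E := by linarith
  have hM0 : 0 < M := by linarith
  have hinv : u⁻¹ - u₁⁻¹ = -(s * r) * u⁻¹ * u₁⁻¹ := by
    rw [← hdu]; field_simp; ring
  have hM2 : M ≤ M ^ 4 := le_self_pow₀ hM (by norm_num)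
  have hM3 : M ^ 2 ≤ M ^ 4 := pow_le_pow_right₀ hM (by norm_num)
  have hM5 : M ^ 3 ≤ M ^ 4 := pow_le_pow_right₀ hM (by norm_num)
  have hM4 : 1 ≤ M ^ 4 := one_le_pow₀ hM
  have hsu' : s / u ≤ M := by rw [div_le_iff₀ hu]; exact hsu
  have hsu₁' : s / u₁ ≤ M := by rw [div_le_iff₀ hu₁]; exact hsu₁
  have hsu0 : 0 ≤ s / u := by positivity
  have hsu₁0 : 0 ≤ s / u₁ := by positivity
  have quot : ∀ {x y : ℝ}, 0 < y → s / y ≤ M → |x| ≤ M * s → |x / y| ≤ M ^ 2 := by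
    intro x y hy hsy hx
    rw [abs_div, abs_of_pos hy]
    calc |x| / y ≤ M * s / y := by gcongr
      _ = M * (s / y) := by ring
      _ ≤ M * M := by gcongr
      _ = M ^ 2 := by ring
  have hb : |Q / u| ≤ M ^ 2 := quot hu hsu' hQ
  have hb₁ : |Q₁ / u| ≤ M ^ 2 := quot hu hsu' hQ₁
  have hb₂ : |Q₁ / u₁| ≤ M ^ 2 := quot hu₁ hsu₁' hQ₁
  have one : ∀ {x y : ℝ}, x ^ 2 + y ^ 2 = 1 → |x| ≤ 1 ∧ |y| ≤ 1 := by
    intro x y h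
    constructor <;> rw [abs_le_one_iff_mul_self_le_one] <;> nlinarith [sq_nonneg x, sq_nonneg y]
  obtain ⟨p1, q1⟩ := one hsp
  obtain ⟨p2, q2⟩ := one hsp₁
  have mb : ∀ {x y K L : ℝ}, |x| ≤ K → |y| ≤ L → |x * y| ≤ K * L := by
    intro x y K L hx hy
    rw [abs_mul]
    exact mul_le_mul hx hy (abs_nonneg _) ((abs_nonneg _).trans hx)
  have ab : ∀ {x y K L : ℝ}, |x| ≤ K → |y| ≤ L → |x + y| ≤ K + L :=
    fun hx hy => (abs_add_le _ _).trans (add_le_add hx hy)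
  have hsa : |s / u| ≤ M := by rwa [abs_of_nonneg hsu0]
  have hss : |s| ≤ M := by rwa [abs_of_pos hs]
  -- The first component, where unit speed gives `|P - P₁| ≤ M s (|P - P₁| + |Q - Q₁|)`.
  have hPP : |P - P₁| ≤ M * s * (|P - P₁| + |Q - Q₁|) := by
    have e : 2 * (P - P₁) = (P - P₁) * ((1 - P) + (1 - P₁)) + (Q - Q₁) * (-(Q + Q₁)) := by
      linear_combination hsp - hsp₁
    have h1 : |(1 - P) + (1 - P₁)| ≤ M * s + M * s :=
      ab (by rwa [abs_sub_comm]) (by rwa [abs_sub_comm])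
    have h2 : |-(Q + Q₁)| ≤ M * s + M * s := by rw [abs_neg]; exact ab hQ hQ₁
    have h3 := ab (mb (le_refl |P - P₁|) h1) (mb (le_refl |Q - Q₁|) h2)
    rw [← e, abs_mul, abs_two] at h3
    linarith
  have t₁ : 2 * r * (((P - P₁) * s - (u - u₁)) / s ^ 2) ≤
      4 * M ^ 4 * E := by
    have e : 2 * r * (((P - P₁) * s - (u - u₁)) / s ^ 2) =
        2 * r * ((P - P₁) / s) - 2 * r ^ 2 / s := by
      rw [hdu]; field_simp
    have h1 : |(P - P₁) / s| ≤ M * (|P - P₁| + |Q - Q₁|) := by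
      rw [abs_div, abs_of_pos hs, div_le_iff₀ hs]
      linarith
    have h2 := (le_abs_self _).trans (mb (le_refl |r|) h1)
    have h3 : 0 ≤ 2 * r ^ 2 / s := by positivity
    have h4 : |r| * (M * (|P - P₁| + |Q - Q₁|)) ≤ 2 * (M * E) := by
      have e1 := mul_le_mul_of_nonneg_left (abs_mul_abs_le_of_sq_le er ep) hM0.le
      have e2 := mul_le_mul_of_nonneg_left (abs_mul_abs_le_of_sq_le er eq) hM0.le
      linarith
    have h5 := mul_le_mul_of_nonneg_right hM2 hE0
    rw [e]
    linarith
  have t₂ : (P - P₁) * ((-Q ^ 2 * (u - 1 / u) + P * Q * v) -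
        (-Q₁ ^ 2 * (u₁ - 1 / u₁) + P₁ * Q₁ * v₁)) ≤
      4 * (5 * M ^ 4) * E := by
    have e : (-Q ^ 2 * (u - 1 / u) + P * Q * v) - (-Q₁ ^ 2 * (u₁ - 1 / u₁) + P₁ * Q₁ * v₁) =
        (-(Q₁ * Q₁ * s) + -(Q₁ * (Q₁ / u₁) * (s / u))) * r + (Q * v) * (P - P₁) +
        ((-((Q + Q₁) * u) + (Q / u + Q₁ / u)) + P₁ * v) * (Q - Q₁) + (P₁ * Q₁) * (v - v₁) := by
      linear_combination -Q₁ ^ 2 * hdu + Q₁ ^ 2 * hinv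
    rw [e]
    refine mul_linear_le ?_ ?_ ?_ ?_ ep er ep eq ev
    · refine (ab (K := 1 * 1 * M) (L := 1 * M ^ 2 * M) ?_ ?_).trans (by linarith)
      · rw [abs_neg]; exact mb (mb q2 q2) hss
      · rw [abs_neg]; exact mb (mb q2 hb₂) hsa
    · exact (mb q1 hvM).trans (by linarith)
    · refine (ab (ab (K := (1 + 1) * M) ?_ (ab hb hb₁)) (mb p2 hvM)).trans (by linarith)
      rw [abs_neg]; exact mb (ab q1 q2) huM
    · exact (mb p2 q2).trans (by linarith)
  have t₃ : (Q - Q₁) * ((Q * P * (u - 1 / u) - P ^ 2 * v) -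
        (Q₁ * P₁ * (u₁ - 1 / u₁) - P₁ ^ 2 * v₁)) ≤
      4 * (5 * M ^ 4) * E +
        M ^ 4 * (Q - Q₁) ^ 2 := by
    have e : (Q * P * (u - 1 / u) - P ^ 2 * v) - (Q₁ * P₁ * (u₁ - 1 / u₁) - P₁ ^ 2 * v₁) =
        (((Q₁ * P₁ * s) + (Q₁ / u₁) * P₁ * (s / u)) * r +
        ((Q₁ * u + -(Q₁ / u)) + -((P + P₁) * v)) * (P - P₁) +
        (P * u) * (Q - Q₁) + (-(P₁ * P₁)) * (v - v₁)) - (P / u) * (Q - Q₁) := by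
      linear_combination Q₁ * P₁ * hdu - Q₁ * P₁ * hinv
    rw [e, mul_sub]
    have hPu : -(P / u) ≤ M ^ 2 := by
      have h1 : 1 - P ≤ M * s := (le_abs_self _).trans (by rwa [abs_sub_comm])
      have h2 : -P / u ≤ M * s / u := by gcongr; linarith
      have h3 : M * s / u ≤ M * M := by rw [mul_div_assoc]; gcongr
      rw [← neg_div]; linarith
    have h1 : -((Q - Q₁) * (P / u * (Q - Q₁))) ≤ M ^ 4 * (Q - Q₁) ^ 2 := by
      have h2 := mul_le_mul_of_nonneg_right (hPu.trans hM3) nq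
      linarith
    rw [sub_eq_add_neg]
    refine add_le_add (mul_linear_le ?_ ?_ ?_ ?_ eq er ep eq ev) h1
    · refine (ab (mb (mb q2 p2) hss) (mb (mb hb₂ p2) hsa)).trans ?_
      linarith
    · refine (ab (ab (L := M ^ 2) (mb q2 huM) ?_) (L := (1 + 1) * M) ?_).trans (by linarith)
      · rwa [abs_neg]
      · rw [abs_neg]; exact mb (ab p1 p2) hvM
    · exact (mb p1 huM).trans (by linarith)
    · rw [abs_neg]; exact (mb p2 p2).trans (by linarith)
  have t₄ : 2 * (v - v₁) * (Q - Q₁) ≤ 2 * (M ^ 4 * E) := by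
    have h1 := (le_abs_self _).trans_eq (abs_mul (v - v₁) (Q - Q₁))
    have h2 := abs_mul_abs_le_of_sq_le ev eq
    have h3 := mul_le_mul_of_nonneg_right hM4 hE0
    linarith
  have h6 : M ^ 4 * (Q - Q₁) ^ 2 ≤ M ^ 4 * E := by gcongr
  have h7 : 0 ≤ M ^ 4 * E := by positivity
  linarith

/-- The energy of the difference satisfies `E' ≤ C E` in the open interval and is continuous up to
`s = 0`, where it vanishes. -/
theorem IsBoundedProfile.eqOn {a S M : ℝ} {u v P Q u₁ v₁ P₁ Q₁ : ℝ → ℝ} (hM : 1 ≤ M)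
    (hSM : S ≤ M) (h : IsBoundedProfile a S M u v P Q) (h₁ : IsBoundedProfile a S M u₁ v₁ P₁ Q₁) :
    EqOn u u₁ (Icc 0 S) ∧ EqOn v v₁ (Icc 0 S) := by
  have hE : ∀ s ∈ Icc 0 S, ((u s - u₁ s) / s) ^ 2 + (P s - P₁ s) ^ 2 + (Q s - Q₁ s) ^ 2 +
      (v s - v₁ s) ^ 2 = 0 := by
    refine eq_zero_of_deriv_le_mul_self (C := 100 * M ^ 4) ?_ ?_ (fun s _ => by positivity)
      (fun s hs => ?_) (fun s hs => energy_estimate hM hs.1 (hs.2.le.trans hSM) (h.u_pos s hs)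
        (h₁.u_pos s hs) (h.le_u s hs) (h₁.le_u s hs) (h.abs_Q s hs) (h₁.abs_Q s hs)
        (h.abs_P s hs) (h₁.abs_P s hs) (h.speed s hs) (h₁.speed s hs) (h.abs_u s hs)
        (h.abs_v s hs))
    -- At `s = 0` the quotient is `0` by the convention for division, which is also its limit.
    · have hρ : ContinuousOn (fun s => (u s - u₁ s) / s) (Icc 0 S) := by
        intro s hs
        rcases hs.1.eq_or_lt with rfl | hs0
        · have h0 := h.deriv_u_zero.sub h₁.deriv_u_zero
          rw [hasDerivWithinAt_iff_tendsto_slope, sub_self] at h0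
          rw [← continuousWithinAt_sdiff_self, ContinuousWithinAt, div_zero]
          refine h0.congr' (Eventually.of_forall fun t => ?_)
          simp [slope_def_field, h.u_zero, h₁.u_zero]
        · exact ((h.cont_u s hs).sub (h₁.cont_u s hs)).div continuousWithinAt_id hs0.ne'
      exact (((hρ.pow 2).add ((h.cont_P.sub h₁.cont_P).pow 2)).add
        ((h.cont_Q.sub h₁.cont_Q).pow 2)).add ((h.cont_v.sub h₁.cont_v).pow 2)
    · simp [h.P_zero, h₁.P_zero, h.Q_zero, h₁.Q_zero, h.v_zero, h₁.v_zero]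
    · have d₁ := (((h.deriv_u s hs).sub (h₁.deriv_u s hs)).div (hasDerivAt_id s) hs.1.ne').pow 2
      have d₂ := ((h.deriv_P s hs).sub (h₁.deriv_P s hs)).pow 2
      have d₃ := ((h.deriv_Q s hs).sub (h₁.deriv_Q s hs)).pow 2
      have d₄ := ((h.deriv_v s hs).sub (h₁.deriv_v s hs)).pow 2
      refine (((d₁.add d₂).add d₃).add d₄).congr_deriv ?_
      simp

  constructor
  · intro s hs
    have h0 := hE s hs
    have h1 : ((u s - u₁ s) / s) ^ 2 = 0 := by
      nlinarith [sq_nonneg ((u s - u₁ s) / s), sq_nonneg (P s - P₁ s), sq_nonneg (Q s - Q₁ s),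
        sq_nonneg (v s - v₁ s)]
    rcases hs.1.eq_or_lt with rfl | hs0
    · rw [h.u_zero, h₁.u_zero]
    · have h2 := (div_eq_zero_iff.1 (pow_eq_zero_iff two_ne_zero |>.1 h1)).resolve_right hs0.ne'
      linarith
  · intro s hs
    have h0 := hE s hs
    have h1 : (v s - v₁ s) ^ 2 = 0 := by
      nlinarith [sq_nonneg ((u s - u₁ s) / s), sq_nonneg (P s - P₁ s), sq_nonneg (Q s - Q₁ s),
        sq_nonneg (v s - v₁ s)]
    have h2 := pow_eq_zero_iff two_ne_zero |>.1 h1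
    linarith

theorem pos_of_hasDerivWithinAt_of_ne_zero {u : ℝ → ℝ} {S : ℝ} (hc : ContinuousOn u (Icc 0 S))
    (h0 : u 0 = 0) (hd : HasDerivWithinAt u 1 (Icc 0 S) 0) (hne : ∀ s ∈ Ioc 0 S, u s ≠ 0) :
    ∀ s ∈ Ioc 0 S, 0 < u s := by
  intro s hs
  by_contra hneg
  rw [not_lt] at hneg
  rw [hasDerivWithinAt_iff_tendsto_slope] at hd
  have h1 : ∀ᶠ t in 𝓝[>] (0 : ℝ), 0 < slope u 0 t := by
    have hle : 𝓝[>] (0 : ℝ) ≤ 𝓝[Icc 0 S \ {0}] 0 := by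
      rw [Icc_sdiff_left, nhdsWithin_Ioc_eq_nhdsGT (hs.1.trans_le hs.2)]
    exact (hd.mono_left hle).eventually (lt_mem_nhds one_pos)
  obtain ⟨t, ht, ht0, hts⟩ := (h1.and (Ioo_mem_nhdsGT hs.1)).exists
  have hut : 0 < u t := by
    rw [slope_def_field, h0, sub_zero, sub_zero] at ht
    exact (div_pos_iff_of_pos_right ht0).1 ht
  obtain ⟨r, hr, hr0⟩ := intermediate_value_Icc' hts.le
    (hc.mono (Icc_subset_Icc ht0.le hs.2)) ⟨hneg, hut.le⟩
  exact hne r ⟨ht0.trans_le hr.1, hr.2.trans hs.2⟩ hr0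

theorem IsProfileSolution.exists_isBoundedProfile {a S : ℝ} {u v : ℝ → ℝ} (hS : 0 < S)
    (h : IsProfileSolution a S u v) :
    ∃ M P Q, IsBoundedProfile a S M u v P Q := by
  have hI := uniqueDiffOn_Icc hS
  have h0 : (0 : ℝ) ∈ Icc 0 S := left_mem_Icc.2 hS.le
  obtain ⟨P, hP⟩ : ∃ P, P = derivWithin u (Icc 0 S) := ⟨_, rfl⟩
  obtain ⟨Q, hQ⟩ : ∃ Q, Q = derivWithin v (Icc 0 S) := ⟨_, rfl⟩
  have key : ∀ w : ℝ → ℝ, ContDiffOn ℝ 2 w (Icc 0 S) →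
      (∀ s ∈ Icc 0 S, HasDerivWithinAt w (derivWithin w (Icc 0 S) s) (Icc 0 S) s) ∧
      (∀ s ∈ Icc 0 S, HasDerivWithinAt (derivWithin w (Icc 0 S))
        (derivWithin (derivWithin w (Icc 0 S)) (Icc 0 S) s) (Icc 0 S) s) ∧
      ContinuousOn (derivWithin (derivWithin w (Icc 0 S)) (Icc 0 S)) (Icc 0 S) := by
    intro w hw
    have h1 := ((contDiffOn_succ_iff_derivWithin (n := 1) hI).1 hw).2.2
    have h2 := (contDiffOn_one_iff_derivWithin hI).1 h1
    exact ⟨fun s hs => (hw.differentiableOn two_ne_zero s hs).hasDerivWithinAt,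
      fun s hs => (h2.1 s hs).hasDerivWithinAt, h2.2⟩
  obtain ⟨hu', hP', hPc⟩ := key u h.contDiffOn_u
  obtain ⟨hv', hQ', hQc⟩ := key v h.contDiffOn_v
  have hode_u := h.ode_u
  have hode_v := h.ode_v
  have hP0 := h.deriv_u_zero
  have hQ0 := h.deriv_v_zero
  rw [← hP] at hu' hP' hPc hP0
  rw [← hQ] at hv' hQ' hQc hQ0
  simp only [← hP, ← hQ] at hode_u hode_v
  have nhd : ∀ s ∈ Ioo 0 S, Icc 0 S ∈ 𝓝 s := fun s hs => Icc_mem_nhds hs.1 hs.2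
  have ioc : ∀ s ∈ Ioo 0 S, s ∈ Ioc 0 S := fun s hs => Ioo_subset_Ioc_self hs
  have icc : ∀ s ∈ Ioo 0 S, s ∈ Icc 0 S := fun s hs => Ioo_subset_Icc_self hs
  have cu : ContinuousOn u (Icc 0 S) := fun s hs => (hu' s hs).continuousWithinAt
  have cv : ContinuousOn v (Icc 0 S) := fun s hs => (hv' s hs).continuousWithinAt
  have cP : ContinuousOn P (Icc 0 S) := fun s hs => (hP' s hs).continuousWithinAt
  have cQ : ContinuousOn Q (Icc 0 S) := fun s hs => (hQ' s hs).continuousWithinAt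
  have du0 : HasDerivWithinAt u 1 (Icc 0 S) 0 := hP0 ▸ hu' 0 h0
  have upos := pos_of_hasDerivWithinAt_of_ne_zero cu h.u_zero du0 h.u_ne_zero
  have dP : ∀ s ∈ Ioo 0 S,
      HasDerivAt P (-(Q s) ^ 2 * (u s - 1 / u s) + P s * Q s * v s) s := fun s hs => by
    rw [← hode_u s (ioc s hs)]
    exact (hP' s (icc s hs)).hasDerivAt (nhd s hs)
  have dQ : ∀ s ∈ Ioo 0 S,
      HasDerivAt Q (Q s * P s * (u s - 1 / u s) - (P s) ^ 2 * v s) s := fun s hs => by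
    rw [← hode_v s (ioc s hs)]
    exact (hQ' s (icc s hs)).hasDerivAt (nhd s hs)
  -- The speed is constant along solutions.
  have hsp : ∀ s ∈ Icc 0 S, (P s ^ 2 + Q s ^ 2 - 1) ^ 2 = 0 := by
    refine eq_zero_of_deriv_le_mul_self (C := 0) (E' := fun _ => 0)
      ((((cP.pow 2).add (cQ.pow 2)).sub continuousOn_const).pow 2) (by rw [hP0, hQ0]; norm_num)
      (fun s _ => by positivity) (fun s hs => ?_) (fun s hs => by simp)
    refine (((((dP s hs).pow 2).add ((dQ s hs).pow 2)).sub_const 1).pow 2).congr_deriv ?_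
    norm_num
    right
    ring
  -- A lower bound for `u s / s`, from the continuous extension by `1` at `s = 0`.
  have hlow : ∃ m, 0 < m ∧ ∀ s ∈ Ioc 0 S, m ≤ u s / s := by
    have hc : ContinuousOn (Function.update (fun s => u s / s) 0 1) (Icc 0 S) := by
      rw [continuousOn_update_iff]
      refine ⟨fun s hs => ((cu s hs.1).mono sdiff_subset).div continuousWithinAt_id hs.2,
        fun _ => ?_⟩
      rw [hasDerivWithinAt_iff_tendsto_slope] at du0
      refine du0.congr' (Eventually.of_forall fun t => ?_)
      simp [slope_def_field, h.u_zero]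
    obtain ⟨x, hx, hmin⟩ := isCompact_Icc.exists_isMinOn ⟨0, h0⟩ hc
    refine ⟨Function.update (fun s => u s / s) 0 1 x, ?_, fun s hs => ?_⟩
    · rcases hx.1.eq_or_lt with rfl | hx0
      · simp
      · rw [Function.update_of_ne hx0.ne']
        exact div_pos (upos x ⟨hx0, hx.2⟩) hx0
    · have := hmin (Ioc_subset_Icc_self hs)
      simpa [Function.update_of_ne hs.1.ne'] using this
  obtain ⟨m, hm, hmle⟩ := hlow
  obtain ⟨M₁, hM₁⟩ := isCompact_Icc.exists_bound_of_continuousOn hPc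
  obtain ⟨M₂, hM₂⟩ := isCompact_Icc.exists_bound_of_continuousOn hQc
  obtain ⟨M₃, hM₃⟩ := isCompact_Icc.exists_bound_of_continuousOn cu
  obtain ⟨M₄, hM₄⟩ := isCompact_Icc.exists_bound_of_continuousOn cv
  have n₁ := (norm_nonneg _).trans (hM₁ 0 h0)
  have n₂ := (norm_nonneg _).trans (hM₂ 0 h0)
  have n₃ := (norm_nonneg _).trans (hM₃ 0 h0)
  have n₄ := (norm_nonneg _).trans (hM₄ 0 h0)
  have nm : 0 < 1 / m := by positivity
  refine ⟨M₁ + M₂ + M₃ + M₄ + 1 / m, P, Q, cu, cv, cP, cQ, h.u_zero, h.v_zero, hP0, hQ0, du0,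
    fun s hs => (hu' s (icc s hs)).hasDerivAt (nhd s hs),
    fun s hs => (hv' s (icc s hs)).hasDerivAt (nhd s hs), dP, dQ, fun s hs => ?_,
    fun s hs => upos s (ioc s hs), fun s hs => ?_, fun s hs => ?_, fun s hs => ?_,
    fun s hs => ?_, fun s hs => ?_⟩
  · have := pow_eq_zero_iff two_ne_zero |>.1 (hsp s (icc s hs))
    linarith
  · have h1 := hmle s (ioc s hs)
    rw [le_div_iff₀ hs.1] at h1
    have h2 : s ≤ 1 / m * u s := by
      rw [div_mul_eq_mul_div, le_div_iff₀ hm]; linarith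
    have h3 : 0 ≤ (M₁ + M₂ + M₃ + M₄) * u s := by
      have := upos s (ioc s hs)
      positivity
    linarith
  · have h1 := (convex_Icc 0 S).norm_image_sub_le_of_norm_hasDerivWithin_le hQ' hM₂ h0 (icc s hs)
    rw [hQ0, sub_zero, sub_zero, Real.norm_eq_abs, Real.norm_eq_abs, abs_of_pos hs.1] at h1
    exact h1.trans (mul_le_mul_of_nonneg_right (by linarith) hs.1.le)
  · have h1 := (convex_Icc 0 S).norm_image_sub_le_of_norm_hasDerivWithin_le hP' hM₁ h0 (icc s hs)
    rw [hP0, sub_zero, Real.norm_eq_abs, Real.norm_eq_abs, abs_of_pos hs.1] at h1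
    exact h1.trans (mul_le_mul_of_nonneg_right (by linarith) hs.1.le)
  · exact (hM₃ s (icc s hs)).trans (by linarith)
  · exact (hM₄ s (icc s hs)).trans (by linarith)

theorem IsProfileSolution.eqOn {a S : ℝ} {u v u₁ v₁ : ℝ → ℝ} (hS : 0 < S)
    (h₁ : IsProfileSolution a S u₁ v₁) (h : IsProfileSolution a S u v) :
    EqOn u₁ u (Icc 0 S) ∧ EqOn v₁ v (Icc 0 S) := by
  obtain ⟨M, P, Q, hb⟩ := h.exists_isBoundedProfile hS
  obtain ⟨M₁, P₁, Q₁, hb₁⟩ := h₁.exists_isBoundedProfile hS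
  exact IsBoundedProfile.eqOn (M := max (max M M₁) (max 1 S))
    ((le_max_left 1 S).trans (le_max_right _ _)) ((le_max_right 1 S).trans (le_max_right _ _))
    (hb₁.mono ((le_max_right M M₁).trans (le_max_left _ _)))
    (hb.mono ((le_max_left M M₁).trans (le_max_left _ _)))

/-- Two-sided derivatives on the closed interval give a profile solution. Nothing is asked of the
equations at `s = 0`, but `P'` and `Q'` have to be continuous there. -/
theorem isProfileSolution_of_hasDerivAt {a S : ℝ} (hS : 0 < S) {u v P Q P' Q' : ℝ → ℝ}
    (hu : ∀ s ∈ Icc 0 S, HasDerivAt u (P s) s) (hv : ∀ s ∈ Icc 0 S, HasDerivAt v (Q s) s)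
    (hP : ∀ s ∈ Icc 0 S, HasDerivAt P (P' s) s) (hQ : ∀ s ∈ Icc 0 S, HasDerivAt Q (Q' s) s)
    (hP' : ContinuousOn P' (Icc 0 S)) (hQ' : ContinuousOn Q' (Icc 0 S))
    (hu0 : u 0 = 0) (hv0 : v 0 = a) (hP0 : P 0 = 1) (hQ0 : Q 0 = 0)
    (hpos : ∀ s ∈ Ioc 0 S, 0 < u s)
    (hPode : ∀ s ∈ Ioc 0 S, P' s = -(Q s) ^ 2 * (u s - 1 / u s) + P s * Q s * v s)
    (hQode : ∀ s ∈ Ioc 0 S, Q' s = Q s * P s * (u s - 1 / u s) - (P s) ^ 2 * v s) :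
    IsProfileSolution a S u v ∧ derivWithin u (Icc 0 S) S = P S ∧
      derivWithin v (Icc 0 S) S = Q S := by
  have hI := uniqueDiffOn_Icc hS
  have h0 : (0 : ℝ) ∈ Icc 0 S := left_mem_Icc.2 hS.le
  have hd : ∀ {w w' : ℝ → ℝ}, (∀ s ∈ Icc 0 S, HasDerivAt w (w' s) s) →
      EqOn (derivWithin w (Icc 0 S)) w' (Icc 0 S) := fun hw s hs =>
    (hw s hs).hasDerivWithinAt.derivWithin (hI s hs)
  have hdd : ∀ {w w' w'' : ℝ → ℝ}, (∀ s ∈ Icc 0 S, HasDerivAt w (w' s) s) →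
      (∀ s ∈ Icc 0 S, HasDerivAt w' (w'' s) s) →
      EqOn (derivWithin (derivWithin w (Icc 0 S)) (Icc 0 S)) w'' (Icc 0 S) :=
    fun hw hw' s hs => (derivWithin_congr (hd hw) (hd hw hs)).trans (hd hw' hs)
  have hC : ∀ {w w' w'' : ℝ → ℝ}, (∀ s ∈ Icc 0 S, HasDerivAt w (w' s) s) →
      (∀ s ∈ Icc 0 S, HasDerivAt w' (w'' s) s) → ContinuousOn w'' (Icc 0 S) →
      ContDiffOn ℝ 2 w (Icc 0 S) := by
    intro w w' w'' hw hw' hc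
    refine (contDiffOn_succ_iff_derivWithin (n := 1) hI).2
      ⟨fun s hs => (hw s hs).differentiableAt.differentiableWithinAt, fun h => by simp at h, ?_⟩
    refine ContDiffOn.congr ?_ (hd hw)
    rw [contDiffOn_one_iff_derivWithin hI]
    exact ⟨fun s hs => (hw' s hs).differentiableAt.differentiableWithinAt, hc.congr (hd hw')⟩
  have ic : ∀ s ∈ Ioc 0 S, s ∈ Icc 0 S := fun s hs => Ioc_subset_Icc_self hs
  refine ⟨⟨hC hu hP hP', hC hv hQ hQ', hu0, hv0, (hd hu h0).trans hP0, (hd hv h0).trans hQ0,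
    fun s hs => (hpos s hs).ne', fun s hs => ?_, fun s hs => ?_⟩, hd hu (right_mem_Icc.2 hS.le),
    hd hv (right_mem_Icc.2 hS.le)⟩
  · rw [hdd hu hP (ic s hs), hd hu (ic s hs), hd hv (ic s hs), hPode s hs]
  · rw [hdd hv hQ (ic s hs), hd hu (ic s hs), hd hv (ic s hs), hQode s hs]

/-! ### The right angle: the sphere -/

/-- The case of a right angle: the sphere of radius `√2`. -/
theorem exists_profile_of_right_angle :
    ∃ S : ℝ, 0 < S ∧ ∃ u v : ℝ → ℝ, (IsProfileSolution √2 S u v ∧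
      derivWithin u (Icc 0 S) S = 0 ∧ derivWithin v (Icc 0 S) S = -1) ∧
      (∀ s ∈ Ioc 0 S, 0 < u s) ∧ (∀ s ∈ Ico 0 S, 0 < v s) ∧ v S = 0 := by
  have h2 : (0 : ℝ) < √2 := by positivity
  have hsq : √2 * √2 = (2 : ℝ) := Real.mul_self_sqrt (by norm_num)
  have hS : 0 < √2 * (Real.pi / 2) := by positivity
  have hdiv : √2 * (Real.pi / 2) / √2 = Real.pi / 2 := by field_simp
  have hid : ∀ s : ℝ, HasDerivAt (fun s : ℝ => s / √2) (1 / √2) s := fun s =>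
    (hasDerivAt_id s).div_const _
  have hpos : ∀ s ∈ Ioc 0 (√2 * (Real.pi / 2)), 0 < √2 * Real.sin (s / √2) := by
    intro s hs
    refine mul_pos h2 (Real.sin_pos_of_pos_of_lt_pi (div_pos hs.1 h2) ?_)
    have h1 : s / √2 ≤ Real.pi / 2 := by
      rw [← hdiv]; exact div_le_div_of_nonneg_right hs.2 h2.le
    linarith [Real.pi_pos]
  refine ⟨√2 * (Real.pi / 2), hS, fun s => √2 * Real.sin (s / √2),
    fun s => √2 * Real.cos (s / √2), ?_, hpos, ?_, ?_⟩
  · have := isProfileSolution_of_hasDerivAt (a := √2) hS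
      (u := fun s => √2 * Real.sin (s / √2)) (v := fun s => √2 * Real.cos (s / √2))
      (P := fun s => Real.cos (s / √2)) (Q := fun s => -Real.sin (s / √2))
      (P' := fun s => -Real.sin (s / √2) * (1 / √2))
      (Q' := fun s => -(Real.cos (s / √2) * (1 / √2)))
      (fun s _ => ?_) (fun s _ => ?_) (fun s _ => (hid s).cos) (fun s _ => (hid s).sin.neg)
      (by fun_prop) (by fun_prop) (by simp) (by simp) (by simp) (by simp) hpos ?_ ?_
    · simpa [hdiv] using this
    · refine ((hid s).sin.const_mul √2).congr_deriv ?_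
      field_simp
    · refine ((hid s).cos.const_mul √2).congr_deriv ?_
      field_simp
    · intro s hs
      have h3 : Real.sin (s / √2) ≠ 0 := (pos_of_mul_pos_right (hpos s hs) h2.le).ne'
      have h4 := Real.sin_sq_add_cos_sq (s / √2)
      field_simp
      rw [Real.cos_sq']
      linear_combination hsq
    · intro s hs
      have h3 : Real.sin (s / √2) ≠ 0 := (pos_of_mul_pos_right (hpos s hs) h2.le).ne'
      field_simp
      rw [Real.cos_sq']
      linear_combination Real.cos (s / √2) * hsq
  · intro s hs
    refine mul_pos h2 (Real.cos_pos_of_mem_Ioo ⟨?_, ?_⟩)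
    · have : 0 ≤ s / √2 := div_nonneg hs.1 h2.le
      linarith [Real.pi_pos]
    · rw [← hdiv]; exact div_lt_div_of_pos_right hs.2 h2
  · simp [hdiv]

/-! ### Volterra equations depending on a parameter -/

theorem exp_neg_mul_integral_exp_le {l x : ℝ} (hl : 0 < l) :
    Real.exp (-(l * x)) * (x * ∫ r in (0 : ℝ)..1, Real.exp (l * (r * x))) ≤ 1 / l := by
  have h1 : ∫ r in (0 : ℝ)..1, Real.exp (l * (r * x)) * (l * (1 * x)) =
      Real.exp (l * (1 * x)) - Real.exp (l * (0 * x)) := by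
    have hc : Continuous fun r : ℝ => Real.exp (l * (r * x)) * (l * (1 * x)) := by fun_prop
    exact intervalIntegral.integral_eq_sub_of_hasDerivAt
      (fun r _ => (((hasDerivAt_id r).mul_const x).const_mul l).exp) (hc.intervalIntegrable _ _)
  rw [intervalIntegral.integral_mul_const, zero_mul, mul_zero, Real.exp_zero, one_mul] at h1
  have h2 : Real.exp (-(l * x)) * Real.exp (l * x) = 1 := by rw [← Real.exp_add]; simp
  have h3 := Real.exp_pos (-(l * x))
  rw [le_div_iff₀ hl]
  nlinarith

/-- Volterra equations `y(a, x) = y₀(a) + x ∫₀¹ G(r, x, y(a, r x)) dr` with a Lipschitz kernel have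
a solution that is jointly continuous in the parameter `a` and in `x`. Writing the integral over
`[0, x]` as one over `[0, 1]` lets kernels with a regular singular point at `x = 0` take part.
The operator is a contraction for the norm weighted by `exp (-(l * x))`, and the contraction
principle is applied to `exp (-(l * x)) • y`. -/
theorem exists_volterra_solution {E : Type*} [NormedAddCommGroup E] [NormedSpace ℝ E]
    [CompleteSpace E] {G : ℝ → ℝ → E → E} (hG : Continuous fun p : ℝ × ℝ × E => G p.1 p.2.1 p.2.2)
    {A L K : ℝ} (hA : 0 ≤ A) (hL : 0 ≤ L) (hK0 : 0 ≤ K)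
    (hK : ∀ r ∈ Icc (0 : ℝ) 1, ∀ x ∈ Icc 0 L, ∀ y z, ‖G r x y - G r x z‖ ≤ K * ‖y - z‖)
    {y₀ : ℝ → E} (hy₀ : Continuous y₀) :
    ∃ y : ℝ × ℝ → E, Continuous y ∧ ∀ a ∈ Icc 0 A, ∀ x ∈ Icc 0 L,
      y (a, x) = y₀ a + x • ∫ r in (0 : ℝ)..1, G r x (y (a, r * x)) := by
  obtain ⟨l, hl⟩ : ∃ l : ℝ, l = 2 * K + 1 := ⟨_, rfl⟩
  have hl0 : 0 < l := by linarith
  let ext : C(Icc 0 A × Icc 0 L, E) → ℝ × ℝ → E := fun φ p =>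
    φ (projIcc 0 A hA p.1, projIcc 0 L hL p.2)
  have ext_cont : ∀ φ, Continuous (ext φ) := fun φ => φ.continuous.comp
    ((continuous_projIcc.comp continuous_fst).prodMk (continuous_projIcc.comp continuous_snd))
  have ext_sub : ∀ φ ψ p, ‖ext φ p - ext ψ p‖ ≤ ‖φ - ψ‖ := fun φ ψ p =>
    (φ - ψ).norm_coe_le_norm (projIcc 0 A hA p.1, projIcc 0 L hL p.2)
  let F : C(Icc 0 A × Icc 0 L, E) → ℝ × ℝ → ℝ → E := fun φ p r =>
    G r p.2 (Real.exp (l * (r * p.2)) • ext φ (p.1, r * p.2))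
  have F_cont : ∀ φ, Continuous (Function.uncurry (F φ)) := by
    intro φ
    have h1 : Continuous fun q : (ℝ × ℝ) × ℝ =>
        Real.exp (l * (q.2 * q.1.2)) • ext φ (q.1.1, q.2 * q.1.2) :=
      Continuous.smul (by fun_prop) ((ext_cont φ).comp (by fun_prop))
    exact hG.comp (continuous_snd.prodMk ((continuous_snd.comp continuous_fst).prodMk h1))
  let T₀ : C(Icc 0 A × Icc 0 L, E) → ℝ × ℝ → E := fun φ p =>
    Real.exp (-(l * p.2)) • (y₀ p.1 + p.2 • ∫ r in (0 : ℝ)..1, F φ p r)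
  have T₀_cont : ∀ φ, Continuous (T₀ φ) := by
    intro φ
    have h1 := intervalIntegral.continuous_parametric_intervalIntegral_of_continuous'
      (μ := MeasureTheory.volume) (F_cont φ) 0 1
    exact Continuous.smul (by fun_prop)
      ((hy₀.comp continuous_fst).add (continuous_snd.smul h1))
  let T : C(Icc 0 A × Icc 0 L, E) → C(Icc 0 A × Icc 0 L, E) := fun φ =>
    ⟨fun p => T₀ φ (p.1, p.2), (T₀_cont φ).comp (by fun_prop)⟩
  have hT : ContractingWith (1 / 2) T := by
    refine ⟨by norm_num, LipschitzWith.of_dist_le_mul fun φ ψ => ?_⟩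
    rw [ContinuousMap.dist_le (by positivity)]
    rintro ⟨⟨a, ha⟩, ⟨x, hx⟩⟩
    have e : T φ (⟨a, ha⟩, ⟨x, hx⟩) - T ψ (⟨a, ha⟩, ⟨x, hx⟩) =
        Real.exp (-(l * x)) • x • ∫ r in (0 : ℝ)..1, (F φ (a, x) r - F ψ (a, x) r) := by
      rw [intervalIntegral.integral_sub]
      · change Real.exp (-(l * x)) • (y₀ a + x • ∫ r in (0 : ℝ)..1, F φ (a, x) r) -
          Real.exp (-(l * x)) • (y₀ a + x • ∫ r in (0 : ℝ)..1, F ψ (a, x) r) = _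
        rw [← smul_sub, add_sub_add_left_eq_sub, ← smul_sub]
      · exact ((F_cont φ).comp (Continuous.prodMk_right (a, x))).intervalIntegrable _ _
      · exact ((F_cont ψ).comp (Continuous.prodMk_right (a, x))).intervalIntegrable _ _
    have hint : ‖∫ r in (0 : ℝ)..1, (F φ (a, x) r - F ψ (a, x) r)‖ ≤
        (∫ r in (0 : ℝ)..1, Real.exp (l * (r * x))) * (K * ‖φ - ψ‖) := by
      rw [← intervalIntegral.integral_mul_const]
      refine intervalIntegral.norm_integral_le_of_norm_le zero_le_one ?_
        (Continuous.intervalIntegrable (by fun_prop) _ _)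
      refine Eventually.of_forall fun r hr => ?_
      refine (hK r ⟨hr.1.le, hr.2⟩ x hx _ _).trans ?_
      rw [← smul_sub, norm_smul, Real.norm_eq_abs, Real.abs_exp]
      calc K * (Real.exp (l * (r * x)) * ‖ext φ (a, r * x) - ext ψ (a, r * x)‖)
          ≤ K * (Real.exp (l * (r * x)) * ‖φ - ψ‖) := by
            gcongr
            exact ext_sub _ _ _
        _ = Real.exp (l * (r * x)) * (K * ‖φ - ψ‖) := by ring
    rw [dist_eq_norm, e, norm_smul, norm_smul, Real.norm_eq_abs, Real.abs_exp, Real.norm_eq_abs,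
      abs_of_nonneg hx.1, dist_eq_norm]
    calc Real.exp (-(l * x)) * (x * ‖∫ r in (0 : ℝ)..1, (F φ (a, x) r - F ψ (a, x) r)‖)
        ≤ Real.exp (-(l * x)) * (x * ((∫ r in (0 : ℝ)..1, Real.exp (l * (r * x))) *
          (K * ‖φ - ψ‖))) := by
          gcongr
          exact hx.1
      _ = Real.exp (-(l * x)) * (x * ∫ r in (0 : ℝ)..1, Real.exp (l * (r * x))) *
          (K * ‖φ - ψ‖) := by ring
      _ ≤ 1 / l * (K * ‖φ - ψ‖) := by
          gcongr
          exact exp_neg_mul_integral_exp_le hl0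
      _ = K / l * ‖φ - ψ‖ := by ring
      _ ≤ 1 / 2 * ‖φ - ψ‖ := by
          gcongr ?_ * _
          rw [div_le_div_iff₀ hl0 two_pos]
          linarith
      _ = _ := by norm_num
  have : Nonempty C(Icc 0 A × Icc 0 L, E) := ⟨0⟩
  obtain ⟨φ, hφ⟩ : ∃ φ, T φ = φ := ⟨_, hT.fixedPoint_isFixedPt⟩
  refine ⟨fun p => Real.exp (l * p.2) • ext φ p, Continuous.smul (by fun_prop) (ext_cont φ), ?_⟩
  intro a ha x hx
  have h1 : ext φ (a, x) = T₀ φ (a, x) := by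
    have h2 : ext φ (a, x) = φ (⟨a, ha⟩, ⟨x, hx⟩) := by
      simp only [ext]
      rw [projIcc_of_mem hA ha, projIcc_of_mem hL hx]
    rw [h2]
    exact (DFunLike.congr_fun hφ (⟨a, ha⟩, ⟨x, hx⟩)).symm
  simp only [h1]
  change Real.exp (l * x) • Real.exp (-(l * x)) • (_ : E) = _
  rw [smul_smul, ← Real.exp_add, add_neg_cancel, Real.exp_zero, one_smul]

/-! ### The truncated graph equation -/

/-- The sine `q` of the inclination angle, truncated to `[-σ, 0]`. -/
noncomputable def truncSine (σ q : ℝ) : ℝ := max (-σ) (min q 0)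

/-- The height `y`, truncated to `[0, A]`. -/
noncomputable def truncHeight (A y : ℝ) : ℝ := max 0 (min y A)

/-- The slope `tan θ` as a function of the truncated `q = sin θ`. -/
noncomputable def truncSlope (σ q : ℝ) : ℝ := truncSine σ q / √(1 - truncSine σ q ^ 2)

/-- The regular part `x q - f √(1 - q²)` of the equation for `q = sin θ`, truncated. -/
noncomputable def truncForce (σ A x y q : ℝ) : ℝ :=
  x * truncSine σ q - truncHeight A y * √(1 - truncSine σ q ^ 2)

theorem truncSine_mem {σ : ℝ} (hσ : 0 ≤ σ) (q : ℝ) : truncSine σ q ∈ Icc (-σ) 0 :=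
  ⟨le_max_left _ _, max_le (by linarith) (min_le_right _ _)⟩

theorem truncSine_of_mem {σ q : ℝ} (hq : q ∈ Icc (-σ) 0) : truncSine σ q = q := by
  rw [truncSine, min_eq_left hq.2, max_eq_right hq.1]

theorem truncHeight_mem {A : ℝ} (hA : 0 ≤ A) (y : ℝ) : truncHeight A y ∈ Icc 0 A :=
  ⟨le_max_left _ _, max_le hA (min_le_right _ _)⟩

theorem truncHeight_of_mem {A y : ℝ} (hy : y ∈ Icc 0 A) : truncHeight A y = y := by
  rw [truncHeight, min_eq_left hy.2, max_eq_right hy.1]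

theorem abs_max_min_sub_le (b c x y : ℝ) : |max b (min x c) - max b (min y c)| ≤ |x - y| := by
  refine (abs_max_sub_max_le_max _ _ _ _).trans ?_
  rw [sub_self, abs_zero]
  refine max_le (abs_nonneg _) ((abs_min_sub_min_le_max _ _ _ _).trans ?_)
  rw [sub_self, abs_zero]
  exact max_le le_rfl (abs_nonneg _)

theorem continuous_truncSine (σ : ℝ) : Continuous (truncSine σ) := by
  unfold truncSine; fun_prop

theorem sqrt_one_sub_sq_bounds {σ t : ℝ} (ht : t ∈ Icc (-σ) 0) :
    √(1 - σ ^ 2) ≤ √(1 - t ^ 2) ∧ √(1 - t ^ 2) ≤ 1 := by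
  constructor
  · exact Real.sqrt_le_sqrt (by nlinarith [ht.1, ht.2])
  · rw [Real.sqrt_le_left zero_le_one]; nlinarith

theorem sqrt_one_sub_sq_pos {σ : ℝ} (hσ : 0 < σ) (hσ1 : σ < 1) : 0 < √(1 - σ ^ 2) :=
  Real.sqrt_pos.2 (by nlinarith)

theorem sq_sqrt_one_sub_sq {σ t : ℝ} (hσ1 : σ < 1) (ht : t ∈ Icc (-σ) 0) :
    √(1 - t ^ 2) ^ 2 = 1 - t ^ 2 :=
  Real.sq_sqrt (by nlinarith [ht.1, ht.2])

theorem abs_sqrt_sub_sqrt_le {σ s t : ℝ} (hσ : 0 < σ) (hσ1 : σ < 1) (hs : s ∈ Icc (-σ) 0)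
    (ht : t ∈ Icc (-σ) 0) :
    |√(1 - s ^ 2) - √(1 - t ^ 2)| ≤ |s - t| / √(1 - σ ^ 2) := by
  have hc := sqrt_one_sub_sq_pos hσ hσ1
  have h1 := sq_sqrt_one_sub_sq hσ1 hs
  have h2 := sq_sqrt_one_sub_sq hσ1 ht
  have h3 := (sqrt_one_sub_sq_bounds hs).1
  have h4 := (sqrt_one_sub_sq_bounds ht).1
  rw [le_div_iff₀ hc]
  have h5 : |√(1 - s ^ 2) - √(1 - t ^ 2)| * (√(1 - s ^ 2) + √(1 - t ^ 2)) =
      |s - t| * |s + t| := by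
    rw [← abs_of_pos (show 0 < √(1 - s ^ 2) + √(1 - t ^ 2) by linarith), ← abs_mul, ← abs_mul,
      ← abs_neg ((s - t) * (s + t))]
    congr 1
    linear_combination h1 - h2
  have h6 : |s + t| ≤ 2 := abs_le.2 ⟨by linarith [hs.1, ht.1], by linarith [hs.2, ht.2]⟩
  have h7 := mul_le_mul_of_nonneg_left h6 (abs_nonneg (s - t))
  have h8 := mul_le_mul_of_nonneg_left (show 2 * √(1 - σ ^ 2) ≤ √(1 - s ^ 2) + √(1 - t ^ 2) by
    linarith) (abs_nonneg (√(1 - s ^ 2) - √(1 - t ^ 2)))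
  linarith

theorem continuous_truncSlope {σ : ℝ} (hσ : 0 < σ) (hσ1 : σ < 1) : Continuous (truncSlope σ) := by
  have := continuous_truncSine σ
  unfold truncSlope
  refine Continuous.div (by fun_prop) (by fun_prop) fun q => ?_
  exact ((sqrt_one_sub_sq_pos hσ hσ1).trans_le
    (sqrt_one_sub_sq_bounds (truncSine_mem hσ.le q)).1).ne'

theorem continuous_truncForce (σ A : ℝ) :
    Continuous fun p : ℝ × ℝ × ℝ => truncForce σ A p.1 p.2.1 p.2.2 := by
  have := continuous_truncSine σ
  unfold truncForce truncHeight
  fun_prop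

theorem abs_truncSlope_sub_le {σ : ℝ} (hσ : 0 < σ) (hσ1 : σ < 1) (q q' : ℝ) :
    |truncSlope σ q - truncSlope σ q'| ≤
      (1 / √(1 - σ ^ 2) + 1 / √(1 - σ ^ 2) ^ 3) * |q - q'| := by
  have hs := truncSine_mem hσ.le q
  have ht := truncSine_mem hσ.le q'
  have hst : |truncSine σ q - truncSine σ q'| ≤ |q - q'| := abs_max_min_sub_le _ _ _ _
  have h1 := abs_sqrt_sub_sqrt_le hσ hσ1 hs ht
  rw [abs_sub_comm] at h1
  have hc := sqrt_one_sub_sq_pos hσ hσ1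
  have h3 := (sqrt_one_sub_sq_bounds hs).1
  have h4 := (sqrt_one_sub_sq_bounds ht).1
  unfold truncSlope
  generalize truncSine σ q = s at *
  generalize truncSine σ q' = t at *
  generalize √(1 - s ^ 2) = C at *
  generalize √(1 - t ^ 2) = D at *
  generalize √(1 - σ ^ 2) = c at *
  have hC : 0 < C := hc.trans_le h3
  have hD : 0 < D := hc.trans_le h4
  have e : s / C - t / D = (s - t) / C + t * (D - C) / (C * D) := by field_simp; ring
  rw [e]
  have ht1 : |t| ≤ 1 := abs_le.2 ⟨by linarith [ht.1], by linarith [ht.2]⟩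
  have b1 : |(s - t) / C| ≤ |q - q'| / c := by
    rw [abs_div, abs_of_pos hC]; gcongr
  have b2 : |t * (D - C) / (C * D)| ≤ 1 * (|q - q'| / c) / (c * c) := by
    rw [abs_div, abs_mul, abs_of_pos (mul_pos hC hD)]
    gcongr
    exact h1.trans (by gcongr)
  refine (abs_add_le _ _).trans ((add_le_add b1 b2).trans_eq ?_)
  field_simp

theorem abs_truncForce_sub_le {σ A L x : ℝ} (hσ : 0 < σ) (hσ1 : σ < 1) (hA : 0 ≤ A)
    (hx : x ∈ Icc 0 L) (y y' q q' : ℝ) :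
    |truncForce σ A x y q - truncForce σ A x y' q'| ≤
      (L + A / √(1 - σ ^ 2)) * |q - q'| + |y - y'| := by
  have hs := truncSine_mem hσ.le q
  have ht := truncSine_mem hσ.le q'
  have hst : |truncSine σ q - truncSine σ q'| ≤ |q - q'| := abs_max_min_sub_le _ _ _ _
  have hyy : |truncHeight A y - truncHeight A y'| ≤ |y - y'| := abs_max_min_sub_le _ _ _ _
  have hy := truncHeight_mem hA y
  have hc := sqrt_one_sub_sq_pos hσ hσ1
  have h1 := (abs_sqrt_sub_sqrt_le hσ hσ1 hs ht).trans (div_le_div_of_nonneg_right hst hc.le)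
  have h3 := (sqrt_one_sub_sq_bounds ht).2
  have h4 := Real.sqrt_nonneg (1 - truncSine σ q' ^ 2)
  unfold truncForce
  generalize truncSine σ q = s at *
  generalize truncSine σ q' = t at *
  generalize √(1 - s ^ 2) = C at *
  generalize √(1 - t ^ 2) = D at *
  generalize √(1 - σ ^ 2) = c at *
  generalize truncHeight A y = z at *
  generalize truncHeight A y' = z' at *
  have e : x * s - z * C - (x * t - z' * D) = x * (s - t) + -(z * (C - D)) + -((z - z') * D) := by
    ring
  rw [e]
  have b1 : |x * (s - t)| ≤ L * |q - q'| := by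
    rw [abs_mul, abs_of_nonneg hx.1]
    exact mul_le_mul hx.2 hst (abs_nonneg _) (hx.1.trans hx.2)
  have b2 : |-(z * (C - D))| ≤ A * (|q - q'| / c) := by
    rw [abs_neg, abs_mul, abs_of_nonneg hy.1]
    exact mul_le_mul hy.2 h1 (abs_nonneg _) hA
  have b3 : |-((z - z') * D)| ≤ |y - y'| * 1 := by
    rw [abs_neg, abs_mul, abs_of_nonneg h4]
    exact mul_le_mul hyy h3 h4 (abs_nonneg _)
  refine (abs_add_three _ _ _).trans ((add_le_add (add_le_add b1 b2) b3).trans_eq ?_)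
  ring

theorem truncSlope_mem {σ : ℝ} (hσ : 0 < σ) (hσ1 : σ < 1) (t : ℝ) :
    truncSlope σ t ∈ Icc (-(σ / √(1 - σ ^ 2))) 0 ∧ truncSlope σ t ≤ truncSine σ t := by
  have hs := truncSine_mem hσ.le t
  have hc := sqrt_one_sub_sq_pos hσ hσ1
  obtain ⟨h1, h2⟩ := sqrt_one_sub_sq_bounds hs
  have hC := hc.trans_le h1
  unfold truncSlope
  refine ⟨⟨?_, div_nonpos_of_nonpos_of_nonneg hs.2 hC.le⟩, ?_⟩
  · rw [← neg_div, div_le_div_iff₀ hc hC]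
    nlinarith [hs.1, hs.2]
  · rw [div_le_iff₀ hC]
    nlinarith [hs.2]

theorem truncForce_le {σ A : ℝ} (hσ : 0 < σ) {b x y t : ℝ} (hb : b ≤ A) (hb0 : 0 ≤ b)
    (hx : 0 ≤ x) (hy : b ≤ y) : truncForce σ A x y t ≤ -(b * √(1 - σ ^ 2)) := by
  have hs := truncSine_mem hσ.le t
  have h1 := (sqrt_one_sub_sq_bounds hs).1
  have h2 : b ≤ truncHeight A y := le_max_of_le_right (le_min hy hb)
  have h3 : b * √(1 - σ ^ 2) ≤ truncHeight A y * √(1 - truncSine σ t ^ 2) :=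
    mul_le_mul h2 h1 (Real.sqrt_nonneg _) (hb0.trans h2)
  have h4 : x * truncSine σ t ≤ 0 := mul_nonpos_of_nonneg_of_nonpos hx hs.2
  unfold truncForce
  linarith

theorem truncForce_nonpos {σ A : ℝ} (hσ : 0 < σ) (hA : 0 ≤ A) {x y t : ℝ} (hx : 0 ≤ x) :
    truncForce σ A x y t ≤ 0 := by
  have hs := truncSine_mem hσ.le t
  have h3 : 0 ≤ truncHeight A y * √(1 - truncSine σ t ^ 2) :=
    mul_nonneg (truncHeight_mem hA y).1 (Real.sqrt_nonneg _)
  have h4 : x * truncSine σ t ≤ 0 := mul_nonpos_of_nonneg_of_nonpos hx hs.2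
  unfold truncForce
  linarith

/-- A profile written as a graph `v = f(u)` over the radius `x = u`, with `q = sin θ` and
`w = q'`, for the truncated equations `f' = tan θ`, `(x q)' = x (x q - f cos θ)`. The
second one is stated as `x w = x (x q - f cos θ) - q`, which carries no information at `x = 0`;
there the continuity of `w` takes its place. -/
structure IsTruncGraph (σ A L a : ℝ) (f q w : ℝ → ℝ) : Prop where
  f_zero : f 0 = a
  q_zero : q 0 = 0
  cont_w : Continuous w
  deriv_f : ∀ x ∈ Icc 0 L, HasDerivAt f (truncSlope σ (q x)) x
  deriv_q : ∀ x ∈ Icc 0 L, HasDerivAt q (w x) x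
  mul_w : ∀ x ∈ Icc 0 L, x * w x = x * truncForce σ A x (f x) (q x) - q x

/-- The solution operator `h ↦ x⁻¹ ∫₀ˣ t h(t) dt` of `(x q)' = x h`, in the form
`x ∫₀¹ r h(r x) dr`, maps continuous functions to `C¹` functions, also across `x = 0`. -/
theorem hasDerivAt_mul_integral_mul_comp {h : ℝ → ℝ} (hh : Continuous h) (x : ℝ) :
    HasDerivAt (fun x => x * ∫ r in (0 : ℝ)..1, r * h (r * x))
      (h x - ∫ r in (0 : ℝ)..1, r * h (r * x)) x := by
  have hm : Continuous fun x => ∫ r in (0 : ℝ)..1, r * h (r * x) :=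
    intervalIntegral.continuous_parametric_intervalIntegral_of_continuous' (by fun_prop) 0 1
  rcases eq_or_ne x 0 with rfl | hx
  · have h0 : h 0 - ∫ r in (0 : ℝ)..1, r * h (r * 0) = ∫ r in (0 : ℝ)..1, r * h (r * 0) := by
      simp only [mul_zero, intervalIntegral.integral_mul_const, integral_id]
      ring
    rw [h0, hasDerivAt_iff_tendsto_slope]
    refine ((hm.tendsto 0).mono_left nhdsWithin_le_nhds).congr' ?_
    filter_upwards [self_mem_nhdsWithin] with t ht
    have ht : t ≠ 0 := ht
    rw [slope_def_field, zero_mul, sub_zero, sub_zero, mul_div_cancel_left₀ _ ht]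
  · have key : ∀ t : ℝ, t * (t * ∫ r in (0 : ℝ)..1, r * h (r * t)) = ∫ s in (0 : ℝ)..t, s * h s := by
      intro t
      have h1 := intervalIntegral.mul_integral_comp_mul_right (a := 0) (b := 1)
        (f := fun s => s * h s) (c := t)
      rw [zero_mul, one_mul] at h1
      rw [← h1, ← intervalIntegral.integral_const_mul]
      congr 2
      ext r
      ring
    have hI : HasDerivAt (fun t => ∫ s in (0 : ℝ)..t, s * h s) (x * h x) x :=
      (Continuous.integral_hasStrictDerivAt (by fun_prop) 0 x).hasDerivAt
    have hd := hI.div (hasDerivAt_id x) hx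
    refine (hd.congr_deriv ?_).congr_of_eventuallyEq ?_
    · rw [← key x]
      simp only [id]
      field_simp
    · filter_upwards [isOpen_ne.mem_nhds hx] with t ht
      have ht : t ≠ 0 := ht
      simp only [Pi.div_apply, id]
      rw [← key t]
      field_simp

/-- The truncated problem has solutions for all initial heights `a`, jointly continuous in `a`
and `x`. -/
theorem exists_isTruncGraph {σ A L : ℝ} (hσ : 0 < σ) (hσ1 : σ < 1) (hA : 0 ≤ A) (hL : 0 ≤ L) :
    ∃ f q w : ℝ → ℝ → ℝ, (∀ a ∈ Icc 0 A, IsTruncGraph σ A L a (f a) (q a) (w a)) ∧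
      ContinuousOn (Function.uncurry f) (Icc 0 A ×ˢ Icc 0 L) ∧
      ContinuousOn (Function.uncurry q) (Icc 0 A ×ˢ Icc 0 L) := by
  have hc := sqrt_one_sub_sq_pos hσ hσ1
  have hg := continuous_truncSlope hσ hσ1
  have hF := continuous_truncForce σ A
  obtain ⟨K, hKdef⟩ : ∃ K, K = (1 / √(1 - σ ^ 2) + 1 / √(1 - σ ^ 2) ^ 3) +
      ((L + A / √(1 - σ ^ 2)) + 1) := ⟨_, rfl⟩
  have n1 : 0 ≤ 1 / √(1 - σ ^ 2) + 1 / √(1 - σ ^ 2) ^ 3 := by positivity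
  have n2 : 0 ≤ L + A / √(1 - σ ^ 2) := by positivity
  obtain ⟨y, hy, hyeq⟩ := exists_volterra_solution (E := ℝ × ℝ)
    (G := fun r x z => (truncSlope σ z.2, r * truncForce σ A (r * x) z.1 z.2))
    (y₀ := fun a => (a, 0)) (A := A) (L := L) (K := K) (by
      refine Continuous.prodMk (by fun_prop) (Continuous.mul (by fun_prop) ?_)
      exact hF.comp (g := fun p : ℝ × ℝ × ℝ => truncForce σ A p.1 p.2.1 p.2.2)
        (f := fun p : ℝ × ℝ × ℝ × ℝ => (p.1 * p.2.1, p.2.2.1, p.2.2.2)) (by fun_prop)) hA hL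
    (by linarith) (by
      intro r hr x hx z z'
      have d1 : |z.1 - z'.1| ≤ ‖z - z'‖ := norm_fst_le (z - z')
      have d2 : |z.2 - z'.2| ≤ ‖z - z'‖ := norm_snd_le (z - z')
      have hd := norm_nonneg (z - z')
      rw [Prod.mk_sub_mk, Prod.norm_mk]
      refine max_le ?_ ?_
      · refine (abs_truncSlope_sub_le hσ hσ1 _ _).trans ?_
        exact mul_le_mul (by linarith) d2 (abs_nonneg _) (by linarith)
      · have hrx : r * x ∈ Icc 0 L :=
          ⟨mul_nonneg hr.1 hx.1, (mul_le_of_le_one_left hx.1 hr.2).trans hx.2⟩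
        rw [← mul_sub, Real.norm_eq_abs, abs_mul, abs_of_nonneg hr.1]
        refine (mul_le_of_le_one_left (abs_nonneg _) hr.2).trans ?_
        refine (abs_truncForce_sub_le hσ hσ1 hA hrx _ _ _ _).trans ?_
        have e1 := mul_le_mul_of_nonneg_left d2 n2
        have e2 := mul_nonneg n1 hd
        rw [hKdef, add_mul _ _ ‖z - z'‖, add_mul _ 1 ‖z - z'‖, one_mul]
        linarith) (by fun_prop)
  let h : ℝ → ℝ → ℝ := fun a t => truncForce σ A t (y (a, t)).1 (y (a, t)).2
  have hcont : ∀ a, Continuous (h a) := fun a =>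
    hF.comp (g := fun p : ℝ × ℝ × ℝ => truncForce σ A p.1 p.2.1 p.2.2)
      (f := fun t => (t, (y (a, t)).1, (y (a, t)).2)) (by fun_prop)
  have split : ∀ a ∈ Icc 0 A, ∀ x ∈ Icc 0 L,
      (y (a, x)).1 = a + (∫ t in (0 : ℝ)..x, truncSlope σ (y (a, t)).2) ∧
      (y (a, x)).2 = x * ∫ r in (0 : ℝ)..1, r * h a (r * x) := by
    intro a ha x hx
    have c1 : Continuous fun r => truncSlope σ (y (a, r * x)).2 := by fun_prop
    have c2 : Continuous fun r => r * h a (r * x) :=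
      continuous_id.mul ((hcont a).comp (by fun_prop))
    have ip : IntervalIntegrable (fun r => (truncSlope σ (y (a, r * x)).2, r * h a (r * x)))
        MeasureTheory.volume 0 1 :=
      (c1.prodMk c2).intervalIntegrable _ _
    have h1 := hyeq a ha x hx
    constructor
    · have h2 := congrArg Prod.fst h1
      rw [h2, Prod.fst_add, Prod.smul_fst]
      have h3 := (ContinuousLinearMap.fst ℝ ℝ ℝ).intervalIntegral_comp_comm ip
      simp only [ContinuousLinearMap.coe_fst'] at h3
      rw [← h3, smul_eq_mul,
        intervalIntegral.mul_integral_comp_mul_right (f := fun t => truncSlope σ (y (a, t)).2)]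
      simp
    · have h2 := congrArg Prod.snd h1
      rw [h2, Prod.snd_add, Prod.smul_snd]
      have h3 := (ContinuousLinearMap.snd ℝ ℝ ℝ).intervalIntegral_comp_comm ip
      simp only [ContinuousLinearMap.coe_snd'] at h3
      rw [← h3, smul_eq_mul, zero_add]
  refine ⟨fun a x => a + ∫ t in (0 : ℝ)..x, truncSlope σ (y (a, t)).2,
    fun a x => x * ∫ r in (0 : ℝ)..1, r * h a (r * x),
    fun a x => h a x - ∫ r in (0 : ℝ)..1, r * h a (r * x), fun a ha => ?_, ?_, ?_⟩
  · refine ⟨by simp, by simp, ?_, fun x hx => ?_, fun x _ =>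
      hasDerivAt_mul_integral_mul_comp (hcont a) x, fun x hx => ?_⟩
    · refine (hcont a).sub ?_
      have := hcont a
      exact intervalIntegral.continuous_parametric_intervalIntegral_of_continuous' (by fun_prop) 0 1
    · have h1 := (split a ha x hx).2
      change HasDerivAt _ (truncSlope σ (x * ∫ r in (0 : ℝ)..1, r * h a (r * x))) x
      rw [← h1]
      refine HasDerivAt.const_add a ?_
      exact (Continuous.integral_hasStrictDerivAt (by fun_prop) 0 x).hasDerivAt
    · obtain ⟨h1, h2⟩ := split a ha x hx
      change x * (h a x - ∫ r in (0 : ℝ)..1, r * h a (r * x)) =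
        x * truncForce σ A x (a + ∫ t in (0 : ℝ)..x, truncSlope σ (y (a, t)).2)
          (x * ∫ r in (0 : ℝ)..1, r * h a (r * x)) - x * ∫ r in (0 : ℝ)..1, r * h a (r * x)
      rw [← h1, ← h2, mul_sub, ← h2]
  · refine (continuous_fst.comp hy).continuousOn.congr ?_
    rintro ⟨a, x⟩ ⟨ha, hx⟩
    exact (split a ha x hx).1.symm
  · refine (continuous_snd.comp hy).continuousOn.congr ?_
    rintro ⟨a, x⟩ ⟨ha, hx⟩
    exact (split a ha x hx).2.symm

/-! ### Shape of the truncated graphs -/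

namespace IsTruncGraph

variable {σ A L a : ℝ} {f q w : ℝ → ℝ}

theorem continuousOn_f (h : IsTruncGraph σ A L a f q w) : ContinuousOn f (Icc 0 L) :=
  fun x hx => (h.deriv_f x hx).continuousAt.continuousWithinAt

theorem continuousOn_q (h : IsTruncGraph σ A L a f q w) : ContinuousOn q (Icc 0 L) :=
  fun x hx => (h.deriv_q x hx).continuousAt.continuousWithinAt

theorem hasDerivAt_mul_q (h : IsTruncGraph σ A L a f q w) {x : ℝ} (hx : x ∈ Icc 0 L) :
    HasDerivAt (fun t => t * q t) (x * truncForce σ A x (f x) (q x)) x := by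
  refine ((hasDerivAt_id x).mul (h.deriv_q x hx)).congr_deriv ?_
  have := h.mul_w x hx
  simp only [id, one_mul]
  linarith

theorem antitoneOn_f (h : IsTruncGraph σ A L a f q w) (hσ : 0 < σ) (hσ1 : σ < 1) :
    AntitoneOn f (Icc 0 L) :=
  antitoneOn_Icc_of_hasDerivAt_nonpos h.continuousOn_f
    (fun x hx => h.deriv_f x (Ioo_subset_Icc_self hx)) fun _ _ => (truncSlope_mem hσ hσ1 _).1.2

theorem f_le (h : IsTruncGraph σ A L a f q w) (hσ : 0 < σ) (hσ1 : σ < 1) {x : ℝ}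
    (hx : x ∈ Icc 0 L) : f x ≤ a := by
  rw [← h.f_zero]
  exact h.antitoneOn_f hσ hσ1 (left_mem_Icc.2 (hx.1.trans hx.2)) hx hx.1

/-- As long as the curve stays above the height `b`, the quantity `x q` decreases at a definite
rate; afterwards it is still nonincreasing. -/
theorem mul_q_le (h : IsTruncGraph σ A L a f q w) (hσ : 0 < σ) {b z x : ℝ}
    (hb : b ≤ A) (hb0 : 0 ≤ b) (hz : 0 ≤ z) (hzx : z ≤ x) (hx : x ≤ L)
    (hf : ∀ t ∈ Icc 0 z, b ≤ f t) : x * q x ≤ -(b * √(1 - σ ^ 2)) * (z ^ 2 / 2) := by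
  have hc : ContinuousOn (fun t => t * q t) (Icc 0 L) := continuousOn_id.mul h.continuousOn_q
  have h1 : AntitoneOn (fun t => t * q t) (Icc z x) := by
    refine antitoneOn_Icc_of_hasDerivAt_nonpos (hc.mono (Icc_subset_Icc hz hx))
      (fun t ht => h.hasDerivAt_mul_q ⟨hz.trans ht.1.le, ht.2.le.trans hx⟩) fun t ht => ?_
    have ht0 := hz.trans ht.1.le
    exact mul_nonpos_of_nonneg_of_nonpos ht0 (truncForce_nonpos hσ (hb0.trans hb) ht0)
  have h2 : AntitoneOn (fun t => t * q t + b * √(1 - σ ^ 2) * (t ^ 2 / 2)) (Icc 0 z) := by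
    refine antitoneOn_Icc_of_hasDerivAt_nonpos
      (f' := fun t => t * truncForce σ A t (f t) (q t) + b * √(1 - σ ^ 2) * t)
      ((hc.mono (Icc_subset_Icc_right (hzx.trans hx))).add (by fun_prop))
      (fun t ht => ?_) fun t ht => ?_
    · have e : HasDerivAt (fun t : ℝ => b * √(1 - σ ^ 2) * (t ^ 2 / 2)) (b * √(1 - σ ^ 2) * t) t := by
        refine ((((hasDerivAt_id t).pow 2).div_const 2).const_mul _).congr_deriv ?_
        simp
      exact (h.hasDerivAt_mul_q ⟨ht.1.le, ht.2.le.trans (hzx.trans hx)⟩).add e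
    · have := truncForce_le hσ hb hb0 ht.1.le (hf t (Ioo_subset_Icc_self ht)) (t := q t)
      nlinarith [ht.1]
  have e1 := h1 (left_mem_Icc.2 hzx) (right_mem_Icc.2 hzx) hzx
  have e2 := h2 (left_mem_Icc.2 hz) (right_mem_Icc.2 hz) hz
  simp only [zero_mul] at e1 e2
  norm_num at e2
  linarith

theorem q_nonpos (h : IsTruncGraph σ A L a f q w) (hσ : 0 < σ) (hA : 0 ≤ A) (ha : 0 ≤ a) {x : ℝ}
    (hx : x ∈ Icc 0 L) : q x ≤ 0 := by
  rcases hx.1.eq_or_lt with rfl | hx0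
  · exact h.q_zero.le
  · have h1 := h.mul_q_le hσ hA le_rfl le_rfl hx0.le hx.2 (fun t ht => by
      obtain rfl : t = 0 := le_antisymm ht.2 ht.1
      rw [h.f_zero]; exact ha)
    norm_num at h1
    exact nonpos_of_mul_nonpos_right h1 hx0

theorem q_neg (h : IsTruncGraph σ A L a f q w) (hσ : 0 < σ) (hσ1 : σ < 1) (ha : 0 < a)
    (haA : a ≤ A) {x : ℝ} (hx : x ∈ Ioc 0 L) : q x < 0 := by
  have h0 : (0 : ℝ) ∈ Icc 0 L := left_mem_Icc.2 (hx.1.le.trans hx.2)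
  have hc : ContinuousAt f 0 := (h.deriv_f 0 h0).continuousAt
  have h1 : ∀ᶠ t in 𝓝[>] (0 : ℝ), a / 2 < f t :=
    (hc.tendsto.mono_left nhdsWithin_le_nhds).eventually
      (lt_mem_nhds (by rw [h.f_zero]; linarith))
  obtain ⟨z, hz, hz0, hzx⟩ := (h1.and (Ioo_mem_nhdsGT hx.1)).exists
  have hzL : z ∈ Icc 0 L := ⟨hz0.le, hzx.le.trans hx.2⟩
  have h2 := h.mul_q_le hσ (b := a / 2) (by linarith) (by linarith) hz0.le hzx.le hx.2
    (fun t ht => hz.le.trans (h.antitoneOn_f hσ hσ1 ⟨ht.1, ht.2.trans hzL.2⟩ hzL ht.2))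
  have h3 : 0 < a / 2 * √(1 - σ ^ 2) * (z ^ 2 / 2) := by
    have := sqrt_one_sub_sq_pos hσ hσ1
    positivity
  have hx0 := hx.1
  by_contra hneg
  have := mul_nonneg hx0.le (not_lt.1 hneg)
  linarith

theorem strictAntiOn_f (h : IsTruncGraph σ A L a f q w) (hσ : 0 < σ) (hσ1 : σ < 1) (ha : 0 < a)
    (haA : a ≤ A) : StrictAntiOn f (Icc 0 L) := by
  refine strictAntiOn_of_deriv_neg (convex_Icc 0 L) h.continuousOn_f fun x hx => ?_
  rw [interior_Icc] at hx
  rw [(h.deriv_f x (Ioo_subset_Icc_self hx)).deriv]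
  have h1 := h.q_neg hσ hσ1 ha haA (Ioo_subset_Ioc_self hx)
  refine (truncSlope_mem hσ hσ1 _).2.trans_lt (max_lt (by linarith) ((min_le_left _ _).trans_lt h1))

/-- The curve reaches the axis before `x = exp (6 / √(1 - σ²))`, whatever its initial height: past
`x = 1` its slope is at most a multiple of `-f(1) / x`. -/
theorem f_right_neg (hσ : 0 < σ) (hσ1 : σ < 1)
    (h : IsTruncGraph σ (3 * σ / √(1 - σ ^ 2)) (Real.exp (6 / √(1 - σ ^ 2))) a f q w)
    (ha : 0 < a) (haA : a ≤ 3 * σ / √(1 - σ ^ 2)) :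
    f (Real.exp (6 / √(1 - σ ^ 2))) < 0 := by
  have hc := sqrt_one_sub_sq_pos hσ hσ1
  obtain ⟨c, hcdef⟩ : ∃ c, c = √(1 - σ ^ 2) := ⟨_, rfl⟩
  rw [← hcdef] at h hc haA ⊢
  have hL : 1 < Real.exp (6 / c) := Real.one_lt_exp_iff.2 (by positivity)
  have m1 : (1 : ℝ) ∈ Icc 0 (Real.exp (6 / c)) := ⟨zero_le_one, hL.le⟩
  have mL : Real.exp (6 / c) ∈ Icc 0 (Real.exp (6 / c)) := ⟨by positivity, le_rfl⟩
  by_contra hneg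
  rw [not_lt] at hneg
  have hb : 0 < f 1 := hneg.trans_lt (h.strictAntiOn_f hσ hσ1 ha haA m1 mL hL)
  have hbA : f 1 ≤ 3 * σ / c := (h.f_le hσ hσ1 m1).trans haA
  have hbσ : c / 3 * f 1 ≤ σ := by
    rw [le_div_iff₀ hc] at hbA; linarith
  have hanti : AntitoneOn (fun x => f x + c / 3 * f 1 * Real.log x)
      (Icc 1 (Real.exp (6 / c))) := by
    refine antitoneOn_Icc_of_hasDerivAt_nonpos
      (f' := fun x => truncSlope σ (q x) + c / 3 * f 1 * x⁻¹) ?_ (fun x hx => ?_) fun x hx => ?_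
    · refine (h.continuousOn_f.mono (Icc_subset_Icc_left zero_le_one)).add
        (ContinuousOn.mul continuousOn_const (Real.continuousOn_log.mono fun x hx => ?_))
      exact (zero_lt_one.trans_le hx.1).ne'
    · have hx0 := zero_lt_one.trans hx.1
      exact (h.deriv_f x ⟨hx0.le, hx.2.le⟩).add
        ((Real.hasDerivAt_log hx0.ne').const_mul _)
    · have hx0 := zero_lt_one.trans hx.1
      have h1 := h.mul_q_le hσ hbA hb.le zero_le_one hx.1.le hx.2.le (fun t ht =>
        h.antitoneOn_f hσ hσ1 ⟨ht.1, ht.2.trans hL.le⟩ m1 ht.2)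
      rw [← hcdef] at h1
      have hcb : 0 < f 1 * c := mul_pos hb hc
      have h2 : truncSine σ (q x) ≤ -(c / 3 * f 1 * x⁻¹) := by
        rw [← div_eq_mul_inv, ← neg_div]
        refine max_le ?_ ((min_le_left _ _).trans ?_)
        · rw [le_div_iff₀ hx0]; nlinarith [hx.1]
        · rw [le_div_iff₀ hx0]; linarith
      have h3 := (truncSlope_mem hσ hσ1 (q x)).2
      linarith
  have h4 := hanti (left_mem_Icc.2 hL.le) (right_mem_Icc.2 hL.le) hL.le
  simp only [Real.log_exp, Real.log_one, mul_zero, add_zero] at h4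
  have h5 : c / 3 * f 1 * (6 / c) = 2 * f 1 := by field_simp; ring
  linarith

/-- For the largest initial height `A`, the angle bound is passed while the curve is still above
the axis. -/
theorem f_nonneg_and_q_le_of_top_height (hσ : 0 < σ) (hσ1 : σ < 1)
    (h : IsTruncGraph σ (3 * σ / √(1 - σ ^ 2)) L (3 * σ / √(1 - σ ^ 2)) f q w) (hL : 3 / 2 ≤ L) :
    0 ≤ f (3 / 2) ∧ q (3 / 2) ≤ -σ := by
  have hc := sqrt_one_sub_sq_pos hσ hσ1
  have hk : 0 < σ / √(1 - σ ^ 2) := by positivity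
  have hA : 3 * σ / √(1 - σ ^ 2) = 3 * (σ / √(1 - σ ^ 2)) := by ring
  have hanti : AntitoneOn (fun x => -f x - σ / √(1 - σ ^ 2) * x) (Icc 0 L) := by
    refine antitoneOn_Icc_of_hasDerivAt_nonpos
      (f' := fun x => -truncSlope σ (q x) - σ / √(1 - σ ^ 2) * 1)
      (h.continuousOn_f.neg.sub (by fun_prop))
      (fun x hx => (h.deriv_f x (Ioo_subset_Icc_self hx)).neg.sub
        ((hasDerivAt_id x).const_mul _)) fun x _ => ?_
    have := (truncSlope_mem hσ hσ1 (q x)).1.1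
    linarith
  have m0 : (0 : ℝ) ∈ Icc 0 L := ⟨le_rfl, by linarith⟩
  have hf : ∀ t ∈ Icc (0 : ℝ) (3 / 2), 3 / 2 * (σ / √(1 - σ ^ 2)) ≤ f t := by
    intro t ht
    have h1 := hanti m0 ⟨ht.1, ht.2.trans hL⟩ ht.1
    simp only [h.f_zero, hA] at h1
    nlinarith [ht.2]
  refine ⟨le_trans (by positivity) (hf (3 / 2) ⟨by norm_num, le_rfl⟩), ?_⟩
  have h2 := h.mul_q_le hσ (by rw [hA]; linarith) (by positivity) (by norm_num) le_rfl hL hf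
  have h3 : 3 / 2 * (σ / √(1 - σ ^ 2)) * √(1 - σ ^ 2) = 3 / 2 * σ := by field_simp
  rw [h3] at h2
  linarith

/-- For `a = 0` the truncated solution is the horizontal plane: `f ≤ 0` switches off the term
`f cos θ`, and what remains is linearly bounded in `q`. -/
theorem q_eq_zero (h : IsTruncGraph σ A L 0 f q w) (hσ : 0 < σ) (hσ1 : σ < 1) (hA : 0 ≤ A) {x : ℝ}
    (hx : x ∈ Icc 0 L) : q x = 0 := by
  have key : ∀ x ∈ Icc 0 L, (x * q x) ^ 2 = 0 := by
    refine eq_zero_of_deriv_le_mul_self (C := 2 * L)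
      ((continuousOn_id.mul h.continuousOn_q).pow 2) (by simp) (fun s _ => sq_nonneg _)
      (fun s hs => (h.hasDerivAt_mul_q (Ioo_subset_Icc_self hs)).pow 2) fun s hs => ?_
    have hsI := Ioo_subset_Icc_self hs
    have hq := h.q_nonpos hσ hA le_rfl hsI
    have h1 : truncForce σ A s (f s) (q s) = s * truncSine σ (q s) := by
      have : truncHeight A (f s) = 0 :=
        max_eq_left ((min_le_left _ _).trans (h.f_le hσ hσ1 hsI))
      rw [truncForce, this]; ring
    have h2 : q s ≤ truncSine σ (q s) := by
      rw [truncSine, min_eq_left hq]; exact le_max_right _ _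
    have h3 := (truncSine_mem hσ.le (q s)).2
    have h4 : q s * truncSine σ (q s) ≤ q s ^ 2 := by nlinarith
    have hs0 := hs.1
    have h5 : s * (s ^ 2 * (q s * truncSine σ (q s))) ≤ L * (s ^ 2 * q s ^ 2) := by
      have h6 : s ^ 2 * (q s * truncSine σ (q s)) ≤ s ^ 2 * q s ^ 2 := by gcongr
      have h7 : 0 ≤ s ^ 2 * q s ^ 2 := by positivity
      nlinarith [hs.2]
    rw [h1]
    norm_num
    linarith
  rcases hx.1.eq_or_lt with rfl | hx0
  · exact h.q_zero
  · have h1 := pow_eq_zero_iff two_ne_zero |>.1 (key x hx)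
    exact (mul_eq_zero.1 h1).resolve_left hx0.ne'

/-- While the curve is above the axis and the truncation is inactive, `q` cannot have an interior
minimum: where `q' = 0`, the equation gives `q'' = q / x² < 0`. -/
theorem not_isMin (h : IsTruncGraph σ A L a f q w) (hσ : 0 < σ) (hσ1 : σ < 1) (ha : 0 < a)
    (haA : a ≤ A) {X x : ℝ} (hX : X ≤ L) (hx : x ∈ Ioo 0 X) (hf : ∀ t ∈ Ioo 0 X, 0 ≤ f t)
    (hq : ∀ t ∈ Ioo 0 X, -σ ≤ q t) (hmin : ∀ t ∈ Ioo 0 X, q x ≤ q t) : False := by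
  have hIL : ∀ t ∈ Ioo 0 X, t ∈ Icc 0 L := fun t ht => ⟨ht.1.le, ht.2.le.trans hX⟩
  have hIX : Ioo 0 X ∈ 𝓝 x := Ioo_mem_nhds hx.1 hx.2
  have hA : 0 ≤ A := ha.le.trans haA
  have hqmem : ∀ t ∈ Ioo 0 X, q t ∈ Icc (-σ) 0 := fun t ht =>
    ⟨hq t ht, h.q_nonpos hσ hA ha.le (hIL t ht)⟩
  have hw : ∀ t ∈ Ioo 0 X, w t = t * q t - f t * √(1 - q t ^ 2) - q t / t := by
    intro t ht
    have h1 := h.mul_w t (hIL t ht)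
    rw [truncForce, truncSine_of_mem (hqmem t ht),
      truncHeight_of_mem ⟨hf t ht, (h.f_le hσ hσ1 (hIL t ht)).trans haA⟩] at h1
    have ht0 := ht.1.ne'
    field_simp
    linarith
  have hlmin : IsLocalMin q x := by
    filter_upwards [hIX] with t ht using hmin t ht
  have hdq : ∀ t ∈ Ioo 0 X, deriv q t = w t := fun t ht => (h.deriv_q t (hIL t ht)).deriv
  have hwx : w x = 0 := by rw [← hdq x hx]; exact hlmin.deriv_eq_zero
  have hqx := h.q_neg hσ hσ1 ha haA ⟨hx.1, hx.2.le.trans hX⟩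
  have hpos : 0 < 1 - q x ^ 2 := by nlinarith [hq x hx]
  have hdqx : HasDerivAt q 0 x := hwx ▸ h.deriv_q x (hIL x hx)
  have hdf : HasDerivAt f (q x / √(1 - q x ^ 2)) x := by
    have := h.deriv_f x (hIL x hx)
    rwa [truncSlope, truncSine_of_mem (hqmem x hx)] at this
  have hdw : HasDerivAt w (q x / x ^ 2) x := by
    have h1 := (((hasDerivAt_id x).mul hdqx).sub
      (hdf.mul (((hdqx.pow 2).const_sub 1).sqrt hpos.ne'))).sub (hdqx.div (hasDerivAt_id x) hx.1.ne')
    refine (h1.congr_deriv ?_).congr_of_eventuallyEq ?_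
    · have := (Real.sqrt_pos.2 hpos).ne'
      simp [div_mul_cancel₀ _ this]
      ring
    · filter_upwards [hIX] with t ht
      rw [hw t ht]
      rfl
  have hev : deriv q =ᶠ[𝓝 x] w := by filter_upwards [hIX] with t ht using hdq t ht
  have hlt : q x / x ^ 2 < 0 := div_neg_of_neg_of_pos hqx (by have := hx.1; positivity)
  have hlmax : IsLocalMax q x := by
    refine isLocalMax_of_deriv_deriv_neg ?_ (by rw [hdq x hx, hwx])
      (h.deriv_q x (hIL x hx)).continuousAt
    rw [hev.deriv_eq, hdw.deriv]
    exact hlt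
  -- A point that is both a local minimum and a local maximum has vanishing second derivative.
  have hconst : q =ᶠ[𝓝 x] fun _ => q x := by
    filter_upwards [hlmin, hlmax] with t h1 h2 using le_antisymm h2 h1
  have h0 : deriv q =ᶠ[𝓝 x] fun _ => 0 := by
    have := hconst.deriv
    simpa using this
  have h1 : deriv w x = 0 := by
    rw [(hev.symm.trans h0).deriv_eq]; simp
  rw [hdw.deriv] at h1
  exact hlt.ne h1

end IsTruncGraph

/-! ### Shooting -/

/-- The shooting argument. Among the initial heights whose curve passes the value `q = -σ` no later
than it reaches the axis, the smallest one gives a curve that does both at the same point. -/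
theorem exists_graph_with_angle {σ : ℝ} (hσ : 0 < σ) (hσ1 : σ < 1) :
    ∃ a X : ℝ, 0 < a ∧ 0 < X ∧ ∃ f q w : ℝ → ℝ, f 0 = a ∧ q 0 = 0 ∧ Continuous w ∧
      (∀ x ∈ Ico 0 X, 0 < f x) ∧ f X = 0 ∧ q X = -σ ∧ (∀ x ∈ Icc 0 X, q x ∈ Icc (-σ) 0) ∧
      (∀ x ∈ Icc 0 X, HasDerivAt f (q x / √(1 - q x ^ 2)) x) ∧
      (∀ x ∈ Icc 0 X, HasDerivAt q (w x) x) ∧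
      ∀ x ∈ Ioc 0 X, w x = x * q x - f x * √(1 - q x ^ 2) - q x / x := by
  have hc := sqrt_one_sub_sq_pos hσ hσ1
  obtain ⟨A, hAdef⟩ : ∃ A, A = 3 * σ / √(1 - σ ^ 2) := ⟨_, rfl⟩
  -- Slopes are at least `-σ / √(1 - σ²)`, so a curve starting at height `A` stays above `A / 2` up
  -- to `x = 3 / 2`; `L` bounds the radius at which the axis is reached.
  obtain ⟨L, hLdef⟩ : ∃ L, L = Real.exp (6 / √(1 - σ ^ 2)) := ⟨_, rfl⟩
  have hA : 0 ≤ A := by rw [hAdef]; positivity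
  have hL : 3 / 2 ≤ L := by
    have h1 : 6 ≤ 6 / √(1 - σ ^ 2) := by
      rw [le_div_iff₀ hc]
      have : √(1 - σ ^ 2) ≤ 1 := (sqrt_one_sub_sq_bounds (σ := σ) ⟨le_rfl, by linarith⟩).2.trans'
        (by rw [neg_sq])
      linarith
    have h2 := Real.add_one_le_exp (6 / √(1 - σ ^ 2))
    rw [hLdef]; linarith
  have hL0 : 0 ≤ L := by linarith
  obtain ⟨f, q, w, hfq, hfc, hqc⟩ := exists_isTruncGraph hσ hσ1 hA hL0
  -- The heights whose curve passes `q = -σ` no later than it reaches the axis.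
  let K : Set (ℝ × ℝ) := Icc 0 A ×ˢ Icc 0 L
  let B : Set (ℝ × ℝ) := K ∩ (Function.uncurry f ⁻¹' Ici 0 ∩ (K ∩ Function.uncurry q ⁻¹' Iic (-σ)))
  have hKc : IsCompact K := isCompact_Icc.prod isCompact_Icc
  have hBc : IsCompact B := by
    refine hKc.of_isClosed_subset ?_ inter_subset_left
    have h1 := hfc.preimage_isClosed_of_isClosed hKc.isClosed isClosed_Ici (t := Ici 0)
    have h2 := hqc.preimage_isClosed_of_isClosed hKc.isClosed isClosed_Iic (t := Iic (-σ))
    have : B = (K ∩ Function.uncurry f ⁻¹' Ici 0) ∩ (K ∩ Function.uncurry q ⁻¹' Iic (-σ)) := by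
      simp only [B, inter_assoc]
    rw [this]
    exact h1.inter h2
  have memB : ∀ {a x}, a ∈ Icc 0 A → x ∈ Icc 0 L → 0 ≤ f a x → q a x ≤ -σ → (a, x) ∈ B :=
    fun ha hx h1 h2 => ⟨⟨ha, hx⟩, h1, ⟨ha, hx⟩, h2⟩
  have hBne : B.Nonempty := by
    have hAA : A ∈ Icc 0 A := ⟨hA, le_rfl⟩
    have h1 := hfq A hAA
    rw [hAdef] at h1
    obtain ⟨h2, h3⟩ := h1.f_nonneg_and_q_le_of_top_height hσ hσ1 hL
    rw [← hAdef] at h2 h3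
    exact ⟨_, memB hAA ⟨by norm_num, hL⟩ h2 h3⟩
  obtain ⟨⟨a, x⟩, ⟨⟨ha, hx⟩, hfx, -, hqx⟩, hmin⟩ :=
    hBc.exists_isMinOn hBne continuous_fst.continuousOn
  have ha : a ∈ Icc 0 A := ha
  have hx : x ∈ Icc 0 L := hx
  have hfx : 0 ≤ f a x := hfx
  have hqx : q a x ≤ -σ := hqx
  have hg := hfq a ha
  have ha0 : 0 < a := by
    refine ha.1.lt_of_ne fun h0 => ?_
    rw [← h0] at hg hqx
    have := hg.q_eq_zero hσ hσ1 hA hx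
    linarith
  have hL' : f a L < 0 := by
    have := hg
    rw [hAdef, hLdef] at this
    rw [hLdef]
    exact this.f_right_neg hσ hσ1 ha0 (by rw [← hAdef]; exact ha.2)
  have hanti := hg.strictAntiOn_f hσ hσ1 ha0 ha.2
  obtain ⟨X, hXL, hX⟩ := intermediate_value_Icc' hL0 hg.continuousOn_f
    ⟨hL'.le, by rw [hg.f_zero]; exact ha.1⟩
  have hX0 : 0 < X := by
    refine hXL.1.lt_of_ne fun h0 => ?_
    rw [← h0, hg.f_zero] at hX
    exact ha0.ne' hX
  have hfpos : ∀ t ∈ Ico 0 X, 0 < f a t := fun t ht => by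
    rw [← hX]; exact hanti ⟨ht.1, ht.2.le.trans hXL.2⟩ hXL ht.2
  have hxX : x ≤ X := by
    by_contra hlt
    have := hanti hXL hx (not_le.1 hlt)
    linarith
  -- By minimality of `a`, the bound `-σ ≤ q` holds up to the axis.
  have hq1 : ∀ t ∈ Ico 0 X, -σ ≤ q a t := by
    intro t ht
    by_contra hlt
    rw [not_le] at hlt
    have htL : t ∈ Icc 0 L := ⟨ht.1, ht.2.le.trans hXL.2⟩
    have hmap : ContinuousOn (fun b : ℝ => (b, t)) (Icc 0 A) := by fun_prop
    have hmaps : MapsTo (fun b : ℝ => (b, t)) (Icc 0 A) K := fun b hb => ⟨hb, htL⟩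
    have c1 : ContinuousWithinAt (fun b => f b t) (Icc 0 A) a := hfc.comp hmap hmaps a ha
    have c2 : ContinuousWithinAt (fun b => q b t) (Icc 0 A) a := hqc.comp hmap hmaps a ha
    have hle : 𝓝[<] a ≤ 𝓝[Icc 0 A] a := by
      rw [← nhdsWithin_Ioo_eq_nhdsLT ha0]
      exact nhdsWithin_mono _ fun b hb => ⟨hb.1.le, hb.2.le.trans ha.2⟩
    have e1 := (c1.mono_left hle).eventually (lt_mem_nhds (hfpos t ht))
    have e2 := (c2.mono_left hle).eventually (gt_mem_nhds hlt)
    obtain ⟨b, ⟨⟨hb1, hb2⟩, hb3⟩⟩ := ((e1.and e2).and (Ioo_mem_nhdsLT ha0)).exists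
    have hba : a ≤ b := hmin (memB ⟨hb3.1.le, hb3.2.le.trans ha.2⟩ htL hb1.le hb2.le)
    exact hba.not_gt hb3.2
  have hqX : -σ ≤ q a X := by
    have hcont : ContinuousWithinAt (q a) (Iio X) X :=
      (hg.deriv_q X hXL).continuousAt.continuousWithinAt
    refine ge_of_tendsto hcont ?_
    filter_upwards [Ioo_mem_nhdsLT hX0] with t ht using hq1 t ⟨ht.1.le, ht.2⟩
  have hq2 : ∀ t ∈ Icc 0 X, -σ ≤ q a t := fun t ht => by
    rcases ht.2.eq_or_lt with rfl | h1
    · exact hqX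
    · exact hq1 t ⟨ht.1, h1⟩
  have hx0 : 0 < x := by
    refine hx.1.lt_of_ne fun h0 => ?_
    rw [← h0, hg.q_zero] at hqx
    linarith
  have hxX' : x = X := by
    by_contra hne
    have hxI : x ∈ Ioo 0 X := ⟨hx0, hxX.lt_of_ne hne⟩
    refine hg.not_isMin hσ hσ1 ha0 ha.2 hXL.2 hxI (fun t ht => (hfpos t ⟨ht.1.le, ht.2⟩).le)
      (fun t ht => hq1 t ⟨ht.1.le, ht.2⟩) (fun t ht => hqx.trans (hq1 t ⟨ht.1.le, ht.2⟩))
  subst hxX'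
  have hIL : ∀ t ∈ Icc 0 x, t ∈ Icc 0 L := fun t ht => ⟨ht.1, ht.2.trans hx.2⟩
  have hqmem : ∀ t ∈ Icc 0 x, q a t ∈ Icc (-σ) 0 := fun t ht =>
    ⟨hq2 t ht, hg.q_nonpos hσ hA ha0.le (hIL t ht)⟩
  refine ⟨a, x, ha0, hx0, f a, q a, w a, hg.f_zero, hg.q_zero, hg.cont_w, hfpos, hX,
    le_antisymm hqx hqX, hqmem, fun t ht => ?_, fun t ht => hg.deriv_q t (hIL t ht),
    fun t ht => ?_⟩
  · have := hg.deriv_f t (hIL t ht)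
    rwa [truncSlope, truncSine_of_mem (hqmem t ht)] at this
  · have ht' := Ioc_subset_Icc_self ht
    have hft : 0 ≤ f a t := by
      rw [← hX]; exact hanti.antitoneOn (hIL t ht') hx ht.2
    have h1 := hg.mul_w t (hIL t ht')
    rw [truncForce, truncSine_of_mem (hqmem t ht'),
      truncHeight_of_mem ⟨hft, (hg.f_le hσ hσ1 (hIL t ht')).trans ha.2⟩] at h1
    have ht0 := ht.1.ne'
    field_simp
    linarith

/-! ### Arc length -/

/-- Inverting an arc length function: the autonomous equation `u' = C(u)` with `0 < C ≤ 1`. -/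
theorem exists_arclength_inverse {C : ℝ → ℝ} (hC : Continuous C) (hpos : ∀ x, 0 < C x)
    (hle : ∀ x, C x ≤ 1) :
    ∃ u : ℝ → ℝ, StrictMono u ∧ Function.Surjective u ∧ u 0 = 0 ∧
      ∀ s, HasDerivAt u (C (u s)) s := by
  have hinv : Continuous fun x => (C x)⁻¹ := hC.inv₀ fun x => (hpos x).ne'
  have hd : ∀ x, HasDerivAt (fun x => ∫ t in (0 : ℝ)..x, (C t)⁻¹) (C x)⁻¹ x := fun x =>
    (hinv.integral_hasStrictDerivAt 0 x).hasDerivAt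
  have h0 : (fun x => ∫ t in (0 : ℝ)..x, (C t)⁻¹) 0 = 0 := by simp
  generalize (fun x => ∫ t in (0 : ℝ)..x, (C t)⁻¹) = φ at hd h0
  have hmono : StrictMono φ := strictMono_of_deriv_pos fun x => by
    rw [(hd x).deriv]; exact inv_pos.2 (hpos x)
  have hsub : Monotone fun x => φ x - x := by
    refine monotone_of_deriv_nonneg (fun x => ((hd x).sub (hasDerivAt_id x)).differentiableAt)
      fun x => ?_
    have := ((hd x).sub (hasDerivAt_id x)).deriv
    change 0 ≤ deriv (φ - id) x
    rw [this, sub_nonneg]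
    exact (one_le_inv₀ (hpos x)).2 (hle x)
  have hsurj : Function.Surjective φ := by
    refine (continuous_iff_continuousAt.2 fun x => (hd x).continuousAt).surjective ?_ ?_
    · refine tendsto_atTop_mono' _ ?_ tendsto_id
      filter_upwards [eventually_ge_atTop 0] with x hx
      have := hsub hx
      simp only [h0, id] at this ⊢
      linarith
    · refine tendsto_atBot_mono' _ ?_ tendsto_id
      filter_upwards [eventually_le_atBot 0] with x hx
      have := hsub hx
      simp only [h0, id] at this ⊢
      linarith
  let e := StrictMono.orderIsoOfSurjective φ hmono hsurj
  have he : ∀ s, φ (e.symm s) = s := e.apply_symm_apply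
  refine ⟨e.symm, e.symm.strictMono, e.symm.surjective, hmono.injective (by rw [he, h0]),
    fun s => ?_⟩
  have h1 := (hd (e.symm s)).of_local_left_inverse e.symm.continuous.continuousAt
    (inv_pos.2 (hpos _)).ne' (Eventually.of_forall he)
  rwa [inv_inv] at h1

/-- Every angle other than the right angle is attained: the graph `v = f(u)` found by shooting,
parametrised by arc length. -/
theorem exists_profile_of_angle {σ : ℝ} (hσ : 0 < σ) (hσ1 : σ < 1) :
    ∃ a : ℝ, 0 < a ∧ ∃ S : ℝ, 0 < S ∧ ∃ u v : ℝ → ℝ,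
      (IsProfileSolution a S u v ∧ derivWithin u (Icc 0 S) S = √(1 - σ ^ 2) ∧
        derivWithin v (Icc 0 S) S = -σ) ∧
      (∀ s ∈ Ioc 0 S, 0 < u s) ∧ (∀ s ∈ Ico 0 S, 0 < v s) ∧ v S = 0 := by
  obtain ⟨a, X, ha, hX, f, q, w, hf0, hq0, hw, hfpos, hfX, hqX, hq, hdf, hdq, hweq⟩ :=
    exists_graph_with_angle hσ hσ1
  have hqc : ContinuousOn q (Icc 0 X) := fun x hx => (hdq x hx).continuousAt.continuousWithinAt
  have hproj : ∀ x, q (projIcc 0 X hX.le x) ∈ Icc (-σ) 0 := fun x => hq _ (projIcc 0 X hX.le x).2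
  -- `q` is only controlled on `[0, X]`, so it is extended by constants before inverting.
  obtain ⟨u, humono, husurj, hu0, hdu⟩ := exists_arclength_inverse
    (C := fun x => √(1 - q (projIcc 0 X hX.le x) ^ 2))
    (by
      have h1 : Continuous fun x => q (projIcc 0 X hX.le x) :=
        hqc.comp_continuous (continuous_subtype_val.comp continuous_projIcc)
          fun x => (projIcc 0 X hX.le x).2
      exact (continuous_const.sub (h1.pow 2)).sqrt)
    (fun x => (sqrt_one_sub_sq_pos hσ hσ1).trans_le (sqrt_one_sub_sq_bounds (hproj x)).1)
    (fun x => (sqrt_one_sub_sq_bounds (hproj x)).2)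
  obtain ⟨S, hS⟩ := husurj X
  have hS0 : 0 < S := humono.lt_iff_lt.1 (by rw [hu0, hS]; exact hX)
  have hmem : ∀ s ∈ Icc 0 S, u s ∈ Icc 0 X := fun s hs => by
    rw [← hu0, ← hS]; exact ⟨humono.monotone hs.1, humono.monotone hs.2⟩
  have hpos : ∀ s ∈ Ioc 0 S, 0 < u s := fun s hs => by rw [← hu0]; exact humono hs.1
  have hdu' : ∀ s ∈ Icc 0 S, HasDerivAt u (√(1 - q (u s) ^ 2)) s := fun s hs => by
    have h1 := hdu s
    simp only [projIcc_of_mem hX.le (hmem s hs)] at h1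
    exact h1
  have hne : ∀ s ∈ Icc 0 S, 0 < 1 - q (u s) ^ 2 := fun s hs => by
    have := hq _ (hmem s hs)
    nlinarith [this.1, this.2]
  have hsq : ∀ s ∈ Icc 0 S, 0 < √(1 - q (u s) ^ 2) := fun s hs => Real.sqrt_pos.2 (hne s hs)
  have hdQ : ∀ s ∈ Icc 0 S,
      HasDerivAt (fun s => q (u s)) (w (u s) * √(1 - q (u s) ^ 2)) s := fun s hs =>
    (hdq _ (hmem s hs)).comp s (hdu' s hs)
  have huc : ContinuousOn u (Icc 0 S) := fun s hs => (hdu' s hs).continuousAt.continuousWithinAt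
  have hQc : ContinuousOn (fun s => q (u s)) (Icc 0 S) := hqc.comp huc hmem
  have hwc : ContinuousOn (fun s => w (u s)) (Icc 0 S) := hw.comp_continuousOn huc
  refine ⟨a, ha, S, hS0, u, fun s => f (u s), ?_, hpos, fun s hs => ?_, by simp only [hS, hfX]⟩
  · have key := isProfileSolution_of_hasDerivAt (a := a) hS0 (u := u) (v := fun s => f (u s))
      (P := fun s => √(1 - q (u s) ^ 2)) (Q := fun s => q (u s))
      (P' := fun s => -(q (u s) * w (u s))) (Q' := fun s => w (u s) * √(1 - q (u s) ^ 2))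
      hdu' (fun s hs => ?_) (fun s hs => ?_) hdQ (hQc.mul hwc).neg (hwc.mul (continuousOn_const.sub (hQc.pow 2)).sqrt) hu0
      (by rw [hu0, hf0]) (by simp [hu0, hq0]) (by rw [hu0, hq0]) hpos (fun s hs => ?_)
      (fun s hs => ?_)
    · rw [hS, hqX, neg_sq] at key
      exact key
    · refine ((hdf _ (hmem s hs)).comp s (hdu' s hs)).congr_deriv ?_
      exact div_mul_cancel₀ _ (hsq s hs).ne'
    · refine ((((hdQ s hs).pow 2).const_sub 1).sqrt (hne s hs).ne').congr_deriv ?_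
      have := (hsq s hs).ne'
      simp only [Pi.pow_apply]
      field_simp
      norm_num
      ring
    · have hs' := Ioc_subset_Icc_self hs
      rw [hweq _ ⟨hpos s hs, (hmem s hs').2⟩]
      have := (hpos s hs).ne'
      field_simp
      ring
    · have hs' := Ioc_subset_Icc_self hs
      rw [hweq _ ⟨hpos s hs, (hmem s hs').2⟩]
      have := (hpos s hs).ne'
      field_simp
      ring
  · refine hfpos _ ⟨(hmem s (Ico_subset_Icc_self hs)).1, ?_⟩
    rw [← hS]; exact humono hs.2

theorem lemma5p10 (α : ℝ) (hα : α ∈ Set.Ico (-(Real.pi / 2)) 0) :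
    ∃ a : ℝ, 0 < a ∧ ∃ S : ℝ, 0 < S ∧ ∃ u v : ℝ → ℝ,
      IsProfileSolution a S u v ∧
      (∀ u₁ v₁ : ℝ → ℝ, IsProfileSolution a S u₁ v₁ →
        Set.EqOn u₁ u (Set.Icc 0 S) ∧ Set.EqOn v₁ v (Set.Icc 0 S)) ∧
      (∀ s ∈ Set.Ioc 0 S, 0 < u s) ∧
      (∀ s ∈ Set.Ico 0 S, 0 < v s) ∧
      v S = 0 ∧
      derivWithin u (Set.Icc 0 S) S = Real.cos α ∧
      derivWithin v (Set.Icc 0 S) S = Real.sin α := by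
  obtain ⟨a, ha, S, hS, u, v, ⟨h, hdu, hdv⟩, hu, hv, hvS⟩ :
      ∃ a : ℝ, 0 < a ∧ ∃ S : ℝ, 0 < S ∧ ∃ u v : ℝ → ℝ,
        (IsProfileSolution a S u v ∧ derivWithin u (Icc 0 S) S = Real.cos α ∧
          derivWithin v (Icc 0 S) S = Real.sin α) ∧
        (∀ s ∈ Ioc 0 S, 0 < u s) ∧ (∀ s ∈ Ico 0 S, 0 < v s) ∧ v S = 0 := by
    rcases hα.1.eq_or_lt with rfl | h1
    · refine ⟨√2, by positivity, ?_⟩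
      simpa using exists_profile_of_right_angle
    · have hpi := Real.pi_pos
      have hσ : 0 < -Real.sin α :=
        neg_pos.2 (Real.sin_neg_of_neg_of_neg_pi_lt hα.2 (by linarith))
      have hcos : 0 < Real.cos α := Real.cos_pos_of_mem_Ioo ⟨h1, by linarith [hα.2]⟩
      have hsc := Real.sin_sq_add_cos_sq α
      have hσ1 : -Real.sin α < 1 := by nlinarith
      have h2 := exists_profile_of_angle hσ hσ1
      have h3 : √(1 - (-Real.sin α) ^ 2) = Real.cos α := by
        rw [neg_sq, ← Real.cos_sq', Real.sqrt_sq hcos.le]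
      rwa [h3, neg_neg] at h2
  exact ⟨a, ha, S, hS, u, v, h, fun u₁ v₁ h₁ => h₁.eqOn hS h, hu, hv, hvS, hdu, hdv⟩
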